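/- **Setting.** Fix integers $N\ge 0$, $N_t,N_r,d\ge 1$ with $d\le\min(N_t,N_r)$, $B\ge 0$, and reals $\theta,\tau,R,\sigma,\zeta,P>0$ with $N\theta<1$. Put $\alpha=P\zeta/d$, $Q=N_tN_r-1$, $\breve a=\frac{(Q+1)d}{Q}-\frac1Q$, $\breve b=(Q-1)\breve a$, $ma=\max(N_t,N_r)$, $mi=\min(N_t,N_r)$. In each slot $t=0,1,\dots$ a scheduler, knowing the queue lengths $q(t)\in\mathbb R_+^N$, either uses interference alignment (IA) with a set $\mathcal L\subseteq\{1,\dots,N\}$ of active pairs, or TDMA-SVD with exactly one active pair. With $L$ active pairs, an active pair $k$ is served $B_k(t)=(1-L\theta)R\cdot\#\{m\le d:\gamma_k^{(m)}\ge\tau\}$ bits, and an inactive pair $0$ bits. The SINRs follow the statistical model $$\gamma_k^{(m)}=\frac{\alpha G}{\sigma^2+\sum_{i\in\mathcal L,i\ne k}\alpha d\,X_iY_i}\ (\text{IA, imperfect}),\quad \gamma_k^{(m)}=\frac{\alpha G}{\sigma^2}\ (\text{IA, perfect}),\quad \gamma_k^{(m)}=\frac{\zeta P}{N_t\sigma^2}\lambda\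 (\text{TDMA-SVD}),$$ with $G\sim\mathrm{Exp}(1)$, $X_i\sim\mathrm{Gamma}(Q,2^{B/Q})$ (shape, rate), $Y_i\sim\mathrm{Beta}(\breve a,\breve b)$, all independent for given $\mathcal L,k,m$, and $\lambda$ with density $\frac1{mi}\sum_{n=0}^{mi-1}\frac{n!}{(n+ma-mi)!}[L_n^{ma-mi}(\lambda)]^2\lambda^{ma-mi}e^{-\lambda}$ on $\lambda\ge0$, where $L_n^{ma-mi}(\lambda)=\sum_{l=0}^n\omega_{n,l}\lambda^l$, $\omega_{n,l}=(-1)^l\frac{(n+ma-mi)!}{(n-l)!\,(ma-mi+l)!\,l!}$, and $\omega_{n,l}=0$ for $l>n$. In the imperfect case assume $N_tN_r\ge 3$, so that $\breve b>0$. The fading is independent over slots. Queues evolve by $q_k(t+1)=\max\{q_k(t)-B_k(t),0\}+A_k(t)$ from any deterministic $q(0)\ge 0$. The arrivals are bounded and nonnegative, independent across users, identically distributed over slots with mean vector $a$, and the pairs (arrivals, fading) are independent over slots. The system is strongly stable if $\limsup_T\frac1T\sum_{t<T}\mathbb E[q_k(t)]<\infty$ for every $k$. The stability region of a policy is the set of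 $a\in\mathbb R^N_+$ such that the system is strongly stable for every arrival process with mean $a$ and every $q(0)$. **Rates.** Let $F=\big(\tfrac{d\tau}{2^{B/Q}}+1\big)^{-Q}{}_2F_1\big(\breve b,Q;\breve a+\breve b;\tfrac{1}{2^{B/Q}/(d\tau)+1}\big)$, $$r(L)=(1-L\theta)dRe^{-\sigma^2\tau/\alpha}F^{L-1},\qquad \mu(L)=(1-L\theta)dRe^{-\sigma^2\tau/\alpha},$$ $$r_{\rm svd}=(1-\theta)dR\sum_{n=0}^{mi-1}\Omega_n\sum_{j=0}^{2n}\kappa_{n,j}\,\Gamma\Big(j+ma-mi+1,\tfrac{N_t\sigma^2\tau}{\zeta P}\Big),$$ where $\Omega_n=\frac{n!}{mi\,(n+ma-mi)!}$, $\kappa_{n,j}=\sum_{i=0}^j\omega_{n,i}\omega_{n,j-i}$ and $\Gamma(\cdot,\cdot)$ is the upper incomplete Gamma function. Let $$L_0=\tfrac12\Big(\tfrac1\theta-\tfrac2{\log F}-\sqrt{(\tfrac2{\log F}-\tfrac1\theta)^2+\tfrac4{\theta\log F}}\Big).$$ $L_{\rm I}$ is the one of $\lfloor L_0\rfloor,\lceil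 L_0\rceil$ with the larger value of $L\,r(L)$, and $L_{\rm P}$ the one of $\lfloor\frac1{2\theta}\rfloor,\lceil\frac1{2\theta}\rceil$ with the larger value of $L\,\mu(L)$ (ties go to the ceiling). Let $S_L=\{s\in\{0,1\}^N:\|s\|_1=L\}$, $I_L=\{r(L)s:s\in S_L\}$, $P_L=\{\mu(L)s:s\in S_L\}$ (empty for $L>N$), $J_1=\{r_{\rm svd}\,s:s\in S_1\}$, and let $\mathcal{CH}$ be the closed convex hull. **Theorem.** Consider a switching policy: in every queue state $q$ it uses the technique, and the active pairs, attaining $$\max\Big\{\max_{s\in\{0,1\}^N}r(\|s\|_1)\,s\cdot q,\ \max_{s\in S_1}r_{\rm svd}\,s\cdot q\Big\}$$ in the imperfect case of IA, with $\mu$ in place of $r$ in the perfect case (ties broken arbitrarily but measurably). Its stability region is characterized by $$\Lambda=\mathcal{CH}\{0,I_1,\dots,I_{L_{\rm I}},J_1\}\ \text{(imperfect case)},\qquad \Lambda=\mathcal{CH}\{0,P_1,\dots,P_{L_{\rm P}},J_1\}\ \text{(perfect case)}.$$ That is, every $a$ in the interior of $\Lambda$ relative to $\mathbb R_+^N$ belongs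 to the stability region of the policy, and that region is contained in $\Lambda$. Moreover, if the system is strongly stable under some measurable policy whose decision is a function of the queue lengths, for some arrival process with mean vector $a$ and some $q(0)\ge0$, then $a\in\Lambda$. -/

import Mathlib

open MeasureTheory ProbabilityTheory Filter Topology

noncomputable section

namespace IASVD

/-! ### Parameters of the symmetric MIMO interference network -/

/-- Parameters of the symmetric network. -/
structure Params where
  /-- number of transmitter-receiver pairs -/
  N : ℕ
  /-- antennas at each transmitter -/
  Nt : ℕ
  /-- antennas at each receiver -/
  Nr : ℕ
  /-- data streams per pair -/
  d : ℕ
  /-- quantization bits per channel matrix (limited backhaul only) -/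
  B : ℕ
  /-- fraction of a slot needed to acquire the CSI of one active user -/
  θ : ℝ
  /-- SINR threshold -/
  τ : ℝ
  /-- bits per slot assigned to a stream whose SINR reaches the threshold -/
  R : ℝ
  /-- noise standard deviation -/
  σ : ℝ
  /-- common path loss coefficient -/
  ζ : ℝ
  /-- transmit power -/
  P : ℝ

/-- Standing assumptions on the parameters. -/
structure Params.Valid (p : Params) : Prop where
  one_le_d : 1 ≤ p.d
  d_le : p.d ≤ min p.Nt p.Nr
  θ_pos : 0 < p.θ
  Nθ_lt : (p.N : ℝ) * p.θ < 1
  τ_pos : 0 < p.τ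
  R_pos : 0 < p.R
  σ_pos : 0 < p.σ
  ζ_pos : 0 < p.ζ
  P_pos : 0 < p.P

/-- The two cases for interference alignment: limited backhaul (quantized CSI) or unlimited
backhaul (perfect global CSI). -/
inductive Backhaul
  | imperfect
  | perfect

variable (p : Params)

/-- `α = P ζ / d`. -/
def Params.α : ℝ := p.P * p.ζ / p.d

/-- `Q = N_t N_r - 1`. -/
def Params.Q : ℕ := p.Nt * p.Nr - 1

/-- `δ = 2 ^ (B / Q)`. -/
def Params.δ : ℝ := (2 : ℝ) ^ ((p.B : ℝ) / (p.Q : ℝ))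

/-- `ă = (Q + 1) d / Q - 1 / Q`. -/
def Params.aBeta : ℝ := ((p.Q : ℝ) + 1) * p.d / p.Q - 1 / p.Q

/-- `b̆ = (Q - 1) ă`. -/
def Params.bBeta : ℝ := ((p.Q : ℝ) - 1) * p.aBeta

/-! ### Average rates of interference alignment (IA) -/

/-- `F = (d τ / 2^{B/Q} + 1)^{-Q} ₂F₁(b̆, Q; ă + b̆; 1 / (2^{B/Q} / (d τ) + 1))`. -/
def Params.F : ℝ :=
  ((p.d * p.τ / p.δ + 1) ^ p.Q)⁻¹ *
    ordinaryHypergeometric p.bBeta (p.Q : ℝ) (p.aBeta + p.bBeta)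
      (1 / (p.δ / (p.d * p.τ) + 1))

/-- Average rate of an active pair in the imperfect case when `L` pairs are active:
`r(L) = (1 - L θ) d R e^{-σ² τ / α} F^{L-1}` (used only for `1 ≤ L`). -/
def Params.r (L : ℕ) : ℝ :=
  (1 - L * p.θ) * p.d * p.R * Real.exp (-(p.σ ^ 2 * p.τ / p.α)) * p.F ^ (L - 1)

/-- Average rate of an active pair in the perfect case when `L` pairs are active:
`μ(L) = (1 - L θ) d R e^{-σ² τ / α}`. -/
def Params.mu (L : ℕ) : ℝ :=
  (1 - L * p.θ) * p.d * p.R * Real.exp (-(p.σ ^ 2 * p.τ / p.α))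

/-- The average rate of IA with `L` active pairs: `r(L)` or `μ(L)`. -/
def Params.iaRate : Backhaul → ℕ → ℝ
  | .imperfect => p.r
  | .perfect => p.mu

/-- The real number at which `L ↦ L r(L)` is maximal. -/
def Params.L0 : ℝ :=
  (1 / p.θ - 2 / Real.log p.F
    - Real.sqrt ((2 / Real.log p.F - 1 / p.θ) ^ 2 + 4 / (p.θ * Real.log p.F))) / 2

/-- The better (for the objective `f`) of the two integers `⌊x⌋`, `⌈x⌉`; ties go to `⌈x⌉`. -/
def bestInteger (f : ℕ → ℝ) (x : ℝ) : ℕ :=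
  if f ⌊x⌋₊ ≤ f ⌈x⌉₊ then ⌈x⌉₊ else ⌊x⌋₊

/-- `L_I`: the best of the two integers nearest to `L₀`, for the total rate `L r(L)`. -/
def Params.LI : ℕ := bestInteger (fun L => (L : ℝ) * p.r L) p.L0

/-- `L_P`: the best of the two integers nearest to `1 / (2 θ)`, for the total rate `L μ(L)`. -/
def Params.LP : ℕ := bestInteger (fun L => (L : ℝ) * p.mu L) (1 / (2 * p.θ))

/-! ### Average rate of TDMA-SVD -/

/-- Upper incomplete Gamma function `Γ(s, x) = ∫_x^∞ t^{s-1} e^{-t} dt`. -/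
def upperGamma (s x : ℝ) : ℝ := ∫ t in Set.Ioi x, t ^ (s - 1) * Real.exp (-t)

/-- `ma = max(N_t, N_r)`. -/
def Params.ma : ℕ := max p.Nt p.Nr

/-- `mi = min(N_t, N_r)`. -/
def Params.mi : ℕ := min p.Nt p.Nr

/-- Coefficient of `λ^l` in the associated Laguerre polynomial `L_n^{ma-mi}(λ)`. -/
def Params.lagCoeff (n l : ℕ) : ℝ :=
  if l ≤ n then
    (-1) ^ l * ((n + (p.ma - p.mi)).factorial : ℝ) /
      (((n - l).factorial : ℝ) * ((p.ma - p.mi + l).factorial : ℝ) * (l.factorial : ℝ))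
  else 0

/-- `Ω_n = n! / (mi (n + ma - mi)!)`. -/
def Params.Omega (n : ℕ) : ℝ :=
  (n.factorial : ℝ) / ((p.mi : ℝ) * ((n + (p.ma - p.mi)).factorial : ℝ))

/-- `κ_j = ∑_{i ≤ j} ω_i ω_{j-i}`, the coefficient of `λ^j` in `L_n^{ma-mi}(λ)²`. -/
def Params.kappa (n j : ℕ) : ℝ :=
  ∑ i ∈ Finset.range (j + 1), p.lagCoeff n i * p.lagCoeff n (j - i)

/-- Average rate of the active pair under TDMA-SVD:
`r_svd = (1 - θ) d R ∑_{n < mi} Ω_n ∑_{j ≤ 2n} κ_j Γ(j + ma - mi + 1, N_t σ² τ / (ζ P))`. -/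
def Params.rsvd : ℝ :=
  (1 - p.θ) * p.d * p.R *
    ∑ n ∈ Finset.range p.mi, p.Omega n *
      ∑ j ∈ Finset.range (2 * n + 1), p.kappa n j *
        upperGamma ((j : ℝ) + ((p.ma - p.mi : ℕ) : ℝ) + 1)
          (p.Nt * p.σ ^ 2 * p.τ / (p.ζ * p.P))

/-! ### Fading, SINR and service -/

/-- Associated Laguerre polynomial `L_n^{ma-mi}`. -/
def Params.laguerre (n : ℕ) (x : ℝ) : ℝ :=
  ∑ l ∈ Finset.range (n + 1), p.lagCoeff n l * x ^ l

/-- Density `(1/mi) ∑_{n < mi} n!/(n+ma-mi)! L_n^{ma-mi}(x)² x^{ma-mi} e^{-x}`, `x ≥ 0`, of an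
unordered eigenvalue of `H Hᴴ` (Gram matrix of the smaller dimension), `H` being an
`N_r × N_t` matrix of i.i.d. standard complex Gaussian entries. -/
def Params.eigenDensity (x : ℝ) : ℝ :=
  if 0 ≤ x then
    1 / (p.mi : ℝ) * ∑ n ∈ Finset.range p.mi,
      (n.factorial : ℝ) / ((n + (p.ma - p.mi)).factorial : ℝ) *
        p.laguerre n x ^ 2 * x ^ (p.ma - p.mi) * Real.exp (-x)
  else 0

/-- Law of an unordered eigenvalue. -/
def Params.eigenLaw : Measure ℝ :=
  (volume : Measure ℝ).withDensity fun x => ENNReal.ofReal (p.eigenDensity x)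

/-- The fading variables of one slot. For the set `s` of pairs active under IA, a pair `k`,
a stream `m` and an interfering pair `i`:
* `c.1 s k m` is the direct gain `|u_kᴴ H_kk v_k|²` of stream `m`;
* `c.2.1 s k m i` is the pair `(X, Y)`, with `X = ‖h_ki‖² e_ki` (squared channel norm times
  quantization error) and `d Y` the sum over the `d` interfering streams of the squared
  projections of the quantization error direction;
* `c.2.2 k m` is the eigenvalue carrying stream `m` of pair `k` under TDMA-SVD. -/
abbrev Params.Fading : Type :=
  (Finset (Fin p.N) → Fin p.N → Fin p.d → ℝ) ×
  (Finset (Fin p.N) → Fin p.N → Fin p.d → Fin p.N → ℝ × ℝ) ×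
  (Fin p.N → Fin p.d → ℝ)

instance : MeasurableSpace p.Fading := Prod.instMeasurableSpace

/-- SINR (SNR in the perfect case) of stream `m` of the active pair `k` under IA with active
set `s`. -/
def Params.sinrIA (b : Backhaul) (c : p.Fading) (s : Finset (Fin p.N)) (k : Fin p.N)
    (m : Fin p.d) : ℝ :=
  match b with
  | .imperfect =>
      p.α * c.1 s k m /
        (p.σ ^ 2 + ∑ i ∈ s.erase k, p.α * (c.2.1 s k m i).1 * (p.d * (c.2.1 s k m i).2))
  | .perfect => p.α * c.1 s k m / p.σ ^ 2

/-- SNR of stream `m` of the active pair `k` under TDMA-SVD. -/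
def Params.snrSVD (c : p.Fading) (k : Fin p.N) (m : Fin p.d) : ℝ :=
  p.ζ * p.P / (p.Nt * p.σ ^ 2) * c.2.2 k m

/-- The statistical model of the fading variables of a slot.
* Direct gains are exponential with parameter `1`.
* In the imperfect case the interference variables `(X_i, Y_i)`, over the interfering pairs `i`,
  are mutually independent and independent of the direct gain, with `X_i ~ Gamma(Q, 2^{B/Q})`
  (shape, rate) and `Y_i ~ Beta(ă, b̆)`.
* The eigenvalues used by TDMA-SVD have the density above.
Nothing is assumed on the joint law across pairs, streams or active sets. -/
structure Params.IsSlotFading {Ω : Type*} [MeasurableSpace Ω] (b : Backhaul) (μ : Measure Ω)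
    (c : Ω → p.Fading) : Prop where
  measurable : Measurable c
  gain : ∀ (s : Finset (Fin p.N)), ∀ k ∈ s, ∀ m : Fin p.d,
    HasLaw (fun ω => (c ω).1 s k m) (expMeasure 1) μ
  interference : b = .imperfect → ∀ (s : Finset (Fin p.N)), ∀ k ∈ s, ∀ m : Fin p.d,
    HasLaw
      (fun ω => ((c ω).1 s k m, fun i : {i : Fin p.N // i ∈ s ∧ i ≠ k} => (c ω).2.1 s k m i))
      ((expMeasure 1).prod
        (Measure.pi fun _ => (gammaMeasure (p.Q : ℝ) p.δ).prod (betaMeasure p.aBeta p.bBeta)))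
      μ
  eigen : ∀ (k : Fin p.N) (m : Fin p.d), HasLaw (fun ω => (c ω).2.2 k m) p.eigenLaw μ

/-- A scheduling decision: the technique together with the active pairs. Under IA any set of
pairs may be active, under TDMA-SVD exactly one pair is active. -/
inductive Decision (N : ℕ)
  | ia (s : Finset (Fin N))
  | svd (j : Fin N)

/-- Bits served: `B_k = (1 - L θ) R ×` (number of streams of `k` reaching the threshold) if `k`
is one of the `L` active pairs, and `B_k = 0` otherwise. -/
def Params.service (b : Backhaul) (c : p.Fading) : Decision p.N → Fin p.N → ℝ
  | .ia s, k =>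
      if k ∈ s then
        (1 - (s.card : ℝ) * p.θ) * ∑ m : Fin p.d, (if p.τ ≤ p.sinrIA b c s k m then p.R else 0)
      else 0
  | .svd j, k =>
      if k = j then
        (1 - p.θ) * ∑ m : Fin p.d, (if p.τ ≤ p.snrSVD c k m then p.R else 0)
      else 0

/-! ### Policies and queues -/

/-- A centralized policy: the decision is a function of the queue lengths. -/
abbrev Policy (N : ℕ) : Type := (Fin N → ℝ) → Decision N

/-- Measurability of a policy (there are finitely many decisions). -/
def Policy.IsMeasurable {N : ℕ} (π : Policy N) : Prop :=
  ∀ D : Decision N, MeasurableSet {q | π q = D}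

/-- Max-Weight value of a decision at queue lengths `q`: `r(‖s‖₁) s · q` (resp. `μ(‖s‖₁) s · q`)
for IA with active set `s`, and `r_svd s · q` for TDMA-SVD. -/
def Params.weight (b : Backhaul) (q : Fin p.N → ℝ) : Decision p.N → ℝ
  | .ia s => p.iaRate b s.card * ∑ k ∈ s, q k
  | .svd j => p.rsvd * q j

/-- The switching policy: in every queue state it selects the technique (and its active pairs)
attaining `max {max_{s ∈ S} r(‖s‖₁) s · q, max_{s ∈ S₁} r_svd s · q}`; ties are broken
arbitrarily. -/
def Params.IsSwitchingPolicy (b : Backhaul) (π : Policy p.N) : Prop :=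
  π.IsMeasurable ∧
    ∀ q : Fin p.N → ℝ, (∀ k, 0 ≤ q k) → ∀ D : Decision p.N, p.weight b q D ≤ p.weight b q (π q)

/-- Queue lengths: `q_k(t+1) = max{q_k(t) - B_k(t), 0} + A_k(t)`, from the initial state `q₀`. -/
def Params.queue {Ω : Type*} (b : Backhaul) (c : ℕ → Ω → p.Fading) (π : Policy p.N)
    (A : ℕ → Ω → Fin p.N → ℝ) (q₀ : Fin p.N → ℝ) : ℕ → Ω → Fin p.N → ℝ
  | 0, _ => q₀
  | t + 1, ω => fun k =>
      max (Params.queue b c π A q₀ t ω k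
        - p.service b (c t ω) (π (Params.queue b c π A q₀ t ω)) k) 0 + A t ω k

/-- Strong stability: `limsup_T (1/T) ∑_{t<T} E[q_k(t)] < ∞` for every `k`. -/
def StronglyStable {Ω : Type*} [MeasurableSpace Ω] {N : ℕ} (μ : Measure Ω)
    (q : ℕ → Ω → Fin N → ℝ) : Prop :=
  ∀ k : Fin N,
    limsup (fun T : ℕ => (∑ t ∈ Finset.range T, ∫⁻ ω, ENNReal.ofReal (q t ω k) ∂μ) / (T : ENNReal))
      atTop < ⊤

/-- Arrival processes with mean vector `a`: bounded, nonnegative, independent across users,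
identically distributed in time, and such that (arrivals, fading) are independent from slot to
slot. -/
structure Params.IsArrival {Ω : Type*} [MeasurableSpace Ω] (μ : Measure Ω) (c : ℕ → Ω → p.Fading)
    (a : Fin p.N → ℝ) (A : ℕ → Ω → Fin p.N → ℝ) : Prop where
  measurable : ∀ t, Measurable (A t)
  bounded : ∃ Amax : ℝ, ∀ t k, ∀ᵐ ω ∂μ, 0 ≤ A t ω k ∧ A t ω k < Amax
  users : ∀ t, iIndepFun (fun k ω => A t ω k) μ
  ident : ∀ t k, IdentDistrib (fun ω => A t ω k) (fun ω => A 0 ω k) μ μ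
  mean : ∀ t k, ∫ ω, A t ω k ∂μ = a k
  slots : iIndepFun (fun t ω => (A t ω, c t ω)) μ

/-- Stability region of a policy: the mean arrival rate vectors for which all the queues are
strongly stable. -/
def Params.stabilityRegion {Ω : Type*} [MeasurableSpace Ω] (b : Backhaul) (μ : Measure Ω)
    (c : ℕ → Ω → p.Fading) (π : Policy p.N) : Set (Fin p.N → ℝ) :=
  {a | (∀ k, 0 ≤ a k) ∧
    ∀ (A : ℕ → Ω → Fin p.N → ℝ) (q₀ : Fin p.N → ℝ), p.IsArrival μ c a A → (∀ k, 0 ≤ q₀ k) →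
      StronglyStable μ (p.queue b c π A q₀)}

/-! ### The polytopes -/

/-- Indicator vector of a set of pairs. -/
def indVec {N : ℕ} (s : Finset (Fin N)) : Fin N → ℝ := fun k => if k ∈ s then 1 else 0

/-- `S_L = {s ∈ {0,1}^N : ‖s‖₁ = L}`. -/
def S (N L : ℕ) : Set (Fin N → ℝ) := {x | ∃ s : Finset (Fin N), s.card = L ∧ x = indVec s}

/-- `I_L = {r(L) s : s ∈ S_L}` (imperfect case), `P_L = {μ(L) s : s ∈ S_L}` (perfect case). -/
def Params.iaPoints (b : Backhaul) (L : ℕ) : Set (Fin p.N → ℝ) :=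
  {x | ∃ s ∈ S p.N L, x = p.iaRate b L • s}

/-- `J_1 = {r_svd s : s ∈ S_1}`. -/
def Params.J1 : Set (Fin p.N → ℝ) := {x | ∃ s ∈ S p.N 1, x = p.rsvd • s}

/-- `L_I` in the imperfect case, `L_P` in the perfect case. -/
def Params.Lmax : Backhaul → ℕ
  | .imperfect => p.LI
  | .perfect => p.LP

/-- `CH{I_1, …, I_{L_I}, J_1}` (imperfect case) and `CH{P_1, …, P_{L_P}, J_1}` (perfect case):
closed convex hull; as usual for rate regions the origin (no pair active) is among the points. -/
def Params.region (b : Backhaul) : Set (Fin p.N → ℝ) :=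
  closedConvexHull ℝ
    ({0} ∪ (⋃ L ∈ Finset.Icc 1 (p.Lmax b), p.iaPoints b L) ∪ p.J1)

/-- Interior of `Λ` relative to the nonnegative orthant. -/
def orthantInterior {N : ℕ} (Λ : Set (Fin N → ℝ)) : Set (Fin N → ℝ) :=
  {a | (∀ k, 0 ≤ a k) ∧ Λ ∈ 𝓝[{x | ∀ k, 0 ≤ x k}] a}

/-- `Λ` characterizes the stability region of the switching policy: that policy is strongly stable
in the interior of `Λ`, its stability region is contained in `Λ`, and no centralized policy
whatsoever is strongly stable for a mean arrival rate vector outside `Λ`. -/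
def Params.IsSwitchingRegion {Ω : Type*} [MeasurableSpace Ω] (b : Backhaul) (μ : Measure Ω)
    (c : ℕ → Ω → p.Fading) (Λ : Set (Fin p.N → ℝ)) : Prop :=
  (∀ π : Policy p.N, p.IsSwitchingPolicy b π →
    orthantInterior Λ ⊆ p.stabilityRegion b μ c π ∧ p.stabilityRegion b μ c π ⊆ Λ) ∧
  ∀ (π : Policy p.N) (a : Fin p.N → ℝ) (A : ℕ → Ω → Fin p.N → ℝ) (q₀ : Fin p.N → ℝ),
    π.IsMeasurable → p.IsArrival μ c a A → (∀ k, 0 ≤ q₀ k) →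
      StronglyStable μ (p.queue b c π A q₀) → a ∈ Λ

end IASVD

end

/-! ### Gamma and Beta integrals, and the interference factor `F`. -/

namespace IASVD

/-! Each decision offers a fixed mean service vector, and the theorem is Max-Weight stability for
the convex hull of these vectors. Besides the queueing argument, two facts are needed: the means are
r(L), μ(L) and r_svd, and decisions with more than L_I (or L_P) active pairs add nothing to the
hull.

Means (`integral_service`). The direct gain is exponential, so given the interference a stream
reaches the threshold with probability the exponential of minus an affine function of the
interference. Averaging over independent interferers gives a product of Laplace transforms, each
equal to `F` (`F_eq_integral`): the Gamma variable is integrated first, and the remaining Beta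
average is an Euler integral of ₂F₁. For TDMA-SVD the Laguerre density is integrated term by term
into incomplete Gamma functions.

Geometry (`rate_mem_region`). The rate per pair decreases with the number of active pairs, which
makes Λ coordinate-convex (`mem_region_of_le`). The total rate over L pairs does not exceed its
value at L_I (or L_P) once L is larger, so a rate vector with that many pairs lies below an average
of vertices with L_I (or L_P) pairs.

Queues. The queues at time t depend only on earlier slots, so in expectation the service may be
replaced by its mean. If a + ε(1,…,1) lies in Λ, the Max-Weight choice gives the quadratic Lyapunov
function a drift of at most C - 2ε ∑ E[q_k] (`stronglyStable_of_mem_region`). Conversely, strong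
stability gives arbitrarily late times T of bounded mean backlog. At such a time a is at most the
time-averaged mean service, a point of Λ by convexity, plus O(1/T); closedness of Λ concludes
(`mem_region_of_stronglyStable`). -/

lemma integral_mem_Ioo_of_ae_mem_Ioo {α : Type*} [MeasurableSpace α] {ν : Measure α}
    [IsProbabilityMeasure ν] {f : α → ℝ} (hf : AEStronglyMeasurable f ν)
    (h : ∀ᵐ x ∂ν, f x ∈ Set.Ioo (0 : ℝ) 1) : ∫ x, f x ∂ν ∈ Set.Ioo (0 : ℝ) 1 := by
  have key : ∀ g : α → ℝ, Integrable g ν → (∀ᵐ x ∂ν, 0 < g x) → 0 < ∫ x, g x ∂ν := by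
    intro g hg hpos
    rw [integral_pos_iff_support_of_nonneg_ae (hpos.mono fun x hx => hx.le) hg]
    have : (Function.support g : Set α) =ᵐ[ν] Set.univ := by
      filter_upwards [hpos] with x hx
      exact propext ⟨fun _ => trivial, fun _ => hx.ne'⟩
    simp [measure_congr this]
  have hi : Integrable f ν := by
    refine Integrable.of_bound hf 1 (h.mono fun x hx => ?_)
    rw [Real.norm_eq_abs, abs_of_pos hx.1]; exact hx.2.le
  refine ⟨key f hi (h.mono fun x hx => hx.1), ?_⟩
  have := key (fun x => 1 - f x) ((integrable_const _).sub hi) (h.mono fun x hx => by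
    have := hx.2; linarith)
  rw [integral_sub (integrable_const _) hi] at this
  simp at this
  exact this

lemma expMeasure_real_Ici {x : ℝ} (hx : 0 ≤ x) :
    (expMeasure 1).real (Set.Ici x) = Real.exp (-x) := by
  have hP : IsProbabilityMeasure (expMeasure 1) := isProbabilityMeasure_expMeasure one_pos
  have hna : NullSingletonClass (expMeasure 1) := by
    unfold expMeasure gammaMeasure; infer_instance
  rw [← Set.compl_Iio, probReal_compl_eq_one_sub measurableSet_Iio,
    measureReal_congr Iio_ae_eq_Iic, ← cdf_eq_real, cdf_expMeasure_eq one_pos]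
  simp [hx]

lemma ae_gammaMeasure_pos (a r : ℝ) : ∀ᵐ x ∂gammaMeasure a r, 0 ≤ x := by
  rw [gammaMeasure, ae_withDensity_iff (by unfold gammaPDF; fun_prop)]
  refine Eventually.of_forall fun x hx => ?_
  by_contra h
  exact hx (gammaPDF_of_neg (not_le.1 h))

lemma ae_betaMeasure_mem_Ioo (a b : ℝ) : ∀ᵐ x ∂betaMeasure a b, x ∈ Set.Ioo (0 : ℝ) 1 := by
  rw [betaMeasure, ae_withDensity_iff (by unfold betaPDF; fun_prop)]
  refine Eventually.of_forall fun x hx => ?_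
  by_contra h
  rw [Set.mem_Ioo, not_and_or, not_lt, not_lt] at h
  rcases h with h | h
  · exact hx (betaPDF_eq_zero_of_nonpos h)
  · exact hx (betaPDF_eq_zero_of_one_le h)

lemma integral_gammaMeasure {a r : ℝ} (ha : 0 < a) (hr : 0 < r) (g : ℝ → ℝ) :
    ∫ x, g x ∂gammaMeasure a r = ∫ x, gammaPDFReal a r x * g x := by
  rw [gammaMeasure, integral_withDensity_eq_integral_toReal_smul (by unfold gammaPDF; fun_prop)
    (by simp [gammaPDF])]
  refine integral_congr_ae (Eventually.of_forall fun x => ?_)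
  simp [gammaPDF, ENNReal.toReal_ofReal (gammaPDFReal_nonneg ha hr x)]

lemma betaPDFReal_nonneg {a b : ℝ} (ha : 0 < a) (hb : 0 < b) (x : ℝ) : 0 ≤ betaPDFReal a b x := by
  by_cases h : 0 < x ∧ x < 1
  · exact (betaPDFReal_pos h.1 h.2 ha hb).le
  · simp [betaPDFReal, h]

lemma integral_betaMeasure {a b : ℝ} (ha : 0 < a) (hb : 0 < b) (g : ℝ → ℝ) :
    ∫ x, g x ∂betaMeasure a b = ∫ x, betaPDFReal a b x * g x := by
  rw [betaMeasure, integral_withDensity_eq_integral_toReal_smul (by unfold betaPDF; fun_prop)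
    (by simp [betaPDF])]
  refine integral_congr_ae (Eventually.of_forall fun x => ?_)
  simp [betaPDF, ENNReal.toReal_ofReal (betaPDFReal_nonneg ha hb x)]

/-- Laplace transform of the Gamma distribution. -/
lemma integral_exp_neg_gammaMeasure {a r c : ℝ} (ha : 0 < a) (hr : 0 < r) (hc : 0 ≤ c) :
    ∫ x, Real.exp (-(c * x)) ∂gammaMeasure a r = (r / (r + c)) ^ a := by
  have hrc : 0 < r + c := by linarith
  have h1 : ∫ x, gammaPDFReal a (r + c) x = 1 := by
    have hP := isProbabilityMeasure_gammaMeasure ha hrc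
    have := integral_gammaMeasure ha hrc (fun _ => 1)
    simpa using this.symm
  rw [integral_gammaMeasure ha hr]
  have h2 : ∀ x, gammaPDFReal a r x * Real.exp (-(c * x)) =
      (r / (r + c)) ^ a * gammaPDFReal a (r + c) x := by
    intro x
    unfold gammaPDFReal
    split_ifs
    · rw [Real.div_rpow hr.le hrc.le, show -((r + c) * x) = -(r * x) + -(c * x) by ring,
        Real.exp_add]
      have := (Real.rpow_pos_of_pos hrc a).ne'
      field_simp
    · simp
  simp_rw [h2]
  rw [integral_const_mul, h1, mul_one]

/-- Turns quotients of Beta functions into quotients of Pochhammer symbols, the shape of the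
coefficients of ₂F₁. -/
lemma Gamma_add_nat {b : ℝ} (hb : 0 < b) (n : ℕ) :
    Real.Gamma (b + n) = (ascPochhammer ℝ n).eval b * Real.Gamma b := by
  induction n with
  | zero => simp
  | succ n ih =>
    rw [Nat.cast_succ, ← add_assoc, Real.Gamma_add_one (by positivity), ih,
      ascPochhammer_succ_eval]
    ring

/-- Moments of `1 - Y` for `Y` of Beta distribution. -/
lemma integral_one_sub_pow_betaMeasure {a b : ℝ} (ha : 0 < a) (hb : 0 < b) (n : ℕ) :
    ∫ y, (1 - y) ^ n ∂betaMeasure a b =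
      (ascPochhammer ℝ n).eval b * ((ascPochhammer ℝ n).eval (a + b))⁻¹ := by
  have hbn : 0 < b + n := by positivity
  have h1 : ∫ x, betaPDFReal a (b + n) x = 1 := by
    have hP := isProbabilityMeasureBeta ha hbn
    have := integral_betaMeasure ha hbn (fun _ => 1)
    simpa using this.symm
  rw [integral_betaMeasure ha hb]
  have h2 : ∀ x, betaPDFReal a b x * (1 - x) ^ n =
      (beta a (b + n) / beta a b) * betaPDFReal a (b + n) x := by
    intro x
    unfold betaPDFReal
    split_ifs with h
    · rw [show b + n - 1 = (b - 1) + n by ring, Real.rpow_add (by linarith [h.2]),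
        Real.rpow_natCast]
      have := (beta_pos ha hb).ne'
      have := (beta_pos ha hbn).ne'
      field_simp
    · simp
  simp_rw [h2]
  rw [integral_const_mul, h1, mul_one, beta, beta, ← add_assoc, Gamma_add_nat hb,
    Gamma_add_nat (add_pos ha hb)]
  have := (Real.Gamma_pos_of_pos ha).ne'
  have := (Real.Gamma_pos_of_pos hb).ne'
  have := (Real.Gamma_pos_of_pos (add_pos ha hb)).ne'
  have := (ascPochhammer_pos n (a + b) (add_pos ha hb)).ne'
  field_simp

/-- The negative binomial series, with its coefficients in the Pochhammer form of the hypergeometric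
series. -/
lemma hasSum_one_sub_pow_inv {Q : ℕ} (hQ : 0 < Q) {x : ℝ} (hx : ‖x‖ < 1) :
    HasSum (fun n : ℕ => ((n.factorial : ℝ)⁻¹ * (ascPochhammer ℝ n).eval (Q : ℝ)) * x ^ n)
      (((1 - x) ^ Q)⁻¹) := by
  obtain ⟨k, rfl⟩ : ∃ k, Q = k + 1 := ⟨Q - 1, by omega⟩
  have := hasSum_choose_mul_geometric_of_norm_lt_one k hx
  rw [one_div] at this
  convert! this using 3 with n
  rw [ascPochhammer_nat_eq_natCast_ascFactorial, Nat.ascFactorial_eq_factorial_mul_choose]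
  push_cast
  rw [← mul_assoc, inv_mul_cancel₀ (by positivity), one_mul, add_comm k n, Nat.choose_symm_add]

/-- Euler integral of the hypergeometric function, against a Beta distribution. -/
lemma integral_inv_pow_betaMeasure {a b z : ℝ} (ha : 0 < a) (hb : 0 < b) (hz : 0 < z) {Q : ℕ}
    (hQ : 0 < Q) :
    ∫ y, ((1 + z * y) ^ Q)⁻¹ ∂betaMeasure a b =
      ((z + 1) ^ Q)⁻¹ * ordinaryHypergeometric b (Q : ℝ) (a + b) (z / (z + 1)) := by
  have hP := isProbabilityMeasureBeta ha hb
  set w := z / (z + 1) with hw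
  have hw0 : 0 < w := by positivity
  have hw1 : w < 1 := by rw [hw, div_lt_one (by positivity)]; linarith
  have hco : ∀ n : ℕ, 0 ≤ (n.factorial : ℝ)⁻¹ * (ascPochhammer ℝ n).eval (Q : ℝ) := fun n =>
    mul_nonneg (by positivity) (ascPochhammer_pos n _ (by exact_mod_cast hQ)).le
  have hwn : ‖w‖ < 1 := by rw [Real.norm_eq_abs, abs_of_pos hw0]; exact hw1
  have hb1 : ∀ᵐ y ∂betaMeasure a b, (1 - y) ∈ Set.Ioo (0 : ℝ) 1 :=
    (ae_betaMeasure_mem_Ioo a b).mono fun y hy => ⟨by linarith [hy.2], by linarith [hy.1]⟩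
  -- Since 1 + z y = (z + 1)(1 - w (1 - y)), the expansion is made in w (1 - y), which lies in (0,
  -- 1) for every z > 0; a series in z y would require z y < 1.
  have h1 : ∫ y, ((1 + z * y) ^ Q)⁻¹ ∂betaMeasure a b =
      ∫ y, ((z + 1) ^ Q)⁻¹ * ((1 - w * (1 - y)) ^ Q)⁻¹ ∂betaMeasure a b := by
    refine integral_congr_ae (Eventually.of_forall fun y => ?_)
    simp only
    rw [← mul_inv, ← mul_pow]
    congr 2
    rw [hw]; field_simp; ring
  have h2 : HasSum (fun n : ℕ => ∫ y, ((n.factorial : ℝ)⁻¹ * (ascPochhammer ℝ n).eval (Q : ℝ)) *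
      (w * (1 - y)) ^ n ∂betaMeasure a b) (∫ y, ((1 - w * (1 - y)) ^ Q)⁻¹ ∂betaMeasure a b) := by
    -- The terms are nonnegative and dominated by the convergent series at w itself, as 0 < 1 - y <
    -- 1 almost surely.
    refine hasSum_integral_of_dominated_convergence
      (fun n _ => ((n.factorial : ℝ)⁻¹ * (ascPochhammer ℝ n).eval (Q : ℝ)) * w ^ n)
      (fun n => by fun_prop) (fun n => hb1.mono fun y hy => ?_)
      (Eventually.of_forall fun y => (hasSum_one_sub_pow_inv hQ hwn).summable)
      (integrable_const _) (hb1.mono fun y hy => hasSum_one_sub_pow_inv hQ ?_)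
    · have : 0 ≤ w * (1 - y) := mul_nonneg hw0.le hy.1.le
      rw [Real.norm_eq_abs, abs_of_nonneg (mul_nonneg (hco n) (pow_nonneg this n))]
      refine mul_le_mul_of_nonneg_left (pow_le_pow_left₀ this ?_ n) (hco n)
      exact mul_le_of_le_one_right hw0.le hy.2.le
    · have : 0 ≤ w * (1 - y) := mul_nonneg hw0.le hy.1.le
      rw [Real.norm_eq_abs, abs_of_nonneg this]
      exact (mul_le_of_le_one_right hw0.le hy.2.le).trans_lt hw1
  rw [h1, integral_const_mul, ← h2.tsum_eq, ordinaryHypergeometric_eq_tsum]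
  congr 1
  refine tsum_congr fun n => ?_
  simp_rw [mul_pow, ← mul_assoc]
  rw [integral_const_mul, integral_one_sub_pow_betaMeasure ha hb, smul_eq_mul]
  ring

namespace Params

variable {p : Params}

lemma δ_pos : 0 < p.δ := Real.rpow_pos_of_pos two_pos _

lemma two_le_Q (h : 3 ≤ p.Nt * p.Nr) : 2 ≤ p.Q := by unfold Q; omega

lemma Valid.d_pos (hp : p.Valid) : (0 : ℝ) < p.d := by exact_mod_cast hp.one_le_d

lemma Valid.α_pos (hp : p.Valid) : 0 < p.α :=
  div_pos (mul_pos hp.P_pos hp.ζ_pos) hp.d_pos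

lemma Valid.aBeta_pos (hp : p.Valid) (h : 3 ≤ p.Nt * p.Nr) : 0 < p.aBeta := by
  have hQ : (2 : ℝ) ≤ p.Q := by exact_mod_cast two_le_Q h
  have hd : (1 : ℝ) ≤ p.d := by exact_mod_cast hp.one_le_d
  unfold aBeta
  rw [← sub_div]
  apply div_pos _ (by linarith)
  nlinarith

lemma Valid.bBeta_pos (hp : p.Valid) (h : 3 ≤ p.Nt * p.Nr) : 0 < p.bBeta := by
  have hQ : (2 : ℝ) ≤ p.Q := by exact_mod_cast two_le_Q h
  exact mul_pos (by linarith) (hp.aBeta_pos h)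

lemma Valid.F_eq_integral_beta (hp : p.Valid) (h : 3 ≤ p.Nt * p.Nr) :
    p.F = ∫ y, ((1 + p.d * p.τ / p.δ * y) ^ p.Q)⁻¹ ∂betaMeasure p.aBeta p.bBeta := by
  have hQ : 0 < p.Q := by have := two_le_Q h; omega
  have hz : 0 < p.d * p.τ / p.δ := div_pos (mul_pos hp.d_pos hp.τ_pos) δ_pos
  rw [integral_inv_pow_betaMeasure (hp.aBeta_pos h) (hp.bBeta_pos h) hz hQ, F]
  congr 2
  have := hp.d_pos
  have := hp.τ_pos
  have := δ_pos (p := p)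
  field_simp
  rw [add_comm]

/-- `F` is the Laplace transform of the interference of one active pair. -/
lemma Valid.F_eq_integral (hp : p.Valid) (h : 3 ≤ p.Nt * p.Nr) :
    ∫ x : ℝ × ℝ, Real.exp (-(p.τ * p.d * |x.1 * x.2|))
      ∂(gammaMeasure (p.Q : ℝ) p.δ).prod (betaMeasure p.aBeta p.bBeta) = p.F := by
  have hQ : 0 < p.Q := by have := two_le_Q h; omega
  have hQ' : (0 : ℝ) < p.Q := by exact_mod_cast hQ
  have hδ : 0 < p.δ := δ_pos
  have hP1 := isProbabilityMeasureBeta (hp.aBeta_pos h) (hp.bBeta_pos h)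
  have hP2 := isProbabilityMeasure_gammaMeasure hQ' hδ
  have hτd : 0 < p.d * p.τ := mul_pos hp.d_pos hp.τ_pos
  have hz : 0 < p.d * p.τ / p.δ := div_pos hτd hδ
  rw [integral_prod_symm]
  · have h1 : ∫ y, ∫ x, Real.exp (-(p.τ * p.d * |x * y|)) ∂gammaMeasure (p.Q : ℝ) p.δ
        ∂betaMeasure p.aBeta p.bBeta =
        ∫ y, ((1 + p.d * p.τ / p.δ * y) ^ p.Q)⁻¹ ∂betaMeasure p.aBeta p.bBeta := by
      refine integral_congr_ae ((ae_betaMeasure_mem_Ioo _ _).mono fun y hy => ?_)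
      have hc : 0 ≤ p.τ * p.d * y := mul_nonneg (by linarith) hy.1.le
      calc _ = ∫ x, Real.exp (-(p.τ * p.d * y * x)) ∂gammaMeasure (p.Q : ℝ) p.δ := by
            refine integral_congr_ae ((ae_gammaMeasure_pos _ _).mono fun x hx => ?_)
            simp only
            rw [abs_of_nonneg (mul_nonneg hx hy.1.le)]
            ring_nf
        _ = _ := by
            rw [integral_exp_neg_gammaMeasure hQ' hδ hc, Real.rpow_natCast]
            simp only [← inv_pow]
            congr 1
            have : 0 < p.δ + p.τ * p.d * y := by linarith
            have : 0 < p.δ + p.d * p.τ * y := by linarith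
            field_simp
    rw [h1, hp.F_eq_integral_beta h]
  · refine Integrable.of_bound (by fun_prop) 1 (Eventually.of_forall fun x => ?_)
    rw [Real.norm_eq_abs, abs_of_pos (Real.exp_pos _), Real.exp_le_one_iff, neg_nonpos]
    exact mul_nonneg (by linarith) (abs_nonneg _)

/-- `F` is the mean of (1 + z Y)^{-Q} with z, Y > 0. Strictness matters: it gives log F < 0, on
which the analysis of `L0` rests. -/
lemma Valid.F_mem_Ioo (hp : p.Valid) (h : 3 ≤ p.Nt * p.Nr) : p.F ∈ Set.Ioo (0 : ℝ) 1 := by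
  have hQ : 0 < p.Q := by have := two_le_Q h; omega
  have hP1 := isProbabilityMeasureBeta (hp.aBeta_pos h) (hp.bBeta_pos h)
  have hz : 0 < p.d * p.τ / p.δ := div_pos (mul_pos hp.d_pos hp.τ_pos) δ_pos
  rw [hp.F_eq_integral_beta h]
  refine integral_mem_Ioo_of_ae_mem_Ioo (by fun_prop)
    ((ae_betaMeasure_mem_Ioo _ _).mono fun y hy => ?_)
  have : 1 < 1 + p.d * p.τ / p.δ * y := by nlinarith [mul_pos hz hy.1]
  have h3 := one_lt_pow₀ this hQ.ne'
  exact ⟨by positivity, inv_lt_one_of_one_lt₀ h3⟩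

end Params

end IASVD

/-! ### Threshold probabilities and mean service of each decision. -/

namespace IASVD
namespace Params

variable {p : Params}

/-- Mean service of each pair under a decision. -/
noncomputable def rate (p : Params) (b : Backhaul) : Decision p.N → Fin p.N → ℝ
  | .ia s, k => if k ∈ s then p.iaRate b s.card else 0
  | .svd j, k => if k = j then p.rsvd else 0

lemma Valid.card_mul_θ_lt (hp : p.Valid) (s : Finset (Fin p.N)) : (s.card : ℝ) * p.θ < 1 := by
  have h : s.card ≤ p.N := by simpa using s.card_le_univ
  have : (s.card : ℝ) ≤ p.N := by exact_mod_cast h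
  nlinarith [hp.Nθ_lt, hp.θ_pos]

lemma Valid.θ_lt_one (hp : p.Valid) (k : Fin p.N) : p.θ < 1 := by
  simpa using hp.card_mul_θ_lt {k}

lemma Valid.service_mem_Icc (hp : p.Valid) (b : Backhaul) (c : p.Fading) (D : Decision p.N)
    (k : Fin p.N) : p.service b c D k ∈ Set.Icc 0 (p.d * p.R) := by
  have hR := hp.R_pos
  have hdR : (0 : ℝ) ≤ p.d * p.R := by positivity
  have key : ∀ (x : ℝ) (f : Fin p.d → Prop) [∀ m, Decidable (f m)], x ∈ Set.Icc (0 : ℝ) 1 →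
      x * ∑ m : Fin p.d, (if f m then p.R else 0) ∈ Set.Icc 0 (p.d * p.R) := by
    intro x f _ hx
    have h0 : 0 ≤ ∑ m : Fin p.d, (if f m then p.R else 0) :=
      Finset.sum_nonneg fun m _ => by split_ifs <;> linarith
    have h1 : ∑ m : Fin p.d, (if f m then p.R else 0) ≤ p.d * p.R := by
      calc _ ≤ ∑ m : Fin p.d, p.R := Finset.sum_le_sum fun m _ => by split_ifs <;> linarith
        _ = _ := by simp
    exact ⟨mul_nonneg hx.1 h0, (mul_le_of_le_one_left h0 hx.2).trans h1⟩
  cases D with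
  | ia s =>
    simp only [service]
    split_ifs
    · refine key _ _ ⟨by linarith [hp.card_mul_θ_lt s], ?_⟩
      have : 0 ≤ (s.card : ℝ) * p.θ := mul_nonneg (by positivity) hp.θ_pos.le
      linarith
    · exact ⟨le_rfl, hdR⟩
  | svd j =>
    simp only [service]
    split_ifs
    · exact key _ _ ⟨by linarith [hp.θ_lt_one j], by linarith [hp.θ_pos]⟩
    · exact ⟨le_rfl, hdR⟩

lemma measurable_sinrIA (b : Backhaul) (s : Finset (Fin p.N)) (k : Fin p.N) (m : Fin p.d) :
    Measurable fun c : p.Fading => p.sinrIA b c s k m := by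
  have h1 : Measurable fun c : p.Fading => c.1 s k m := by
    have : Measurable fun c : p.Fading => c.1 := measurable_fst
    fun_prop
  have h2 : ∀ i, Measurable fun c : p.Fading => c.2.1 s k m i := by
    intro i
    have : Measurable fun c : p.Fading => c.2.1 := measurable_fst.comp measurable_snd
    fun_prop
  cases b with
  | imperfect => unfold sinrIA; fun_prop
  | perfect => unfold sinrIA; fun_prop

lemma measurable_snrSVD (k : Fin p.N) (m : Fin p.d) :
    Measurable fun c : p.Fading => p.snrSVD c k m := by
  have : Measurable fun c : p.Fading => c.2.2 := measurable_snd.comp measurable_snd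
  unfold snrSVD
  fun_prop

lemma measurable_service (b : Backhaul) (D : Decision p.N) (k : Fin p.N) :
    Measurable fun c : p.Fading => p.service b c D k := by
  cases D with
  | ia s =>
    simp only [service]
    split_ifs
    · refine Measurable.const_mul (Finset.measurable_fun_sum _ fun m _ => ?_) _
      exact Measurable.ite (measurableSet_le measurable_const (measurable_sinrIA b s k m))
        measurable_const measurable_const
    · exact measurable_const
  | svd j =>
    simp only [service]
    split_ifs
    · refine Measurable.const_mul (Finset.measurable_fun_sum _ fun m _ => ?_) _
      exact Measurable.ite (measurableSet_le measurable_const (measurable_snrSVD k m))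
        measurable_const measurable_const
    · exact measurable_const

section Coverage

variable {Ω : Type*} [MeasurableSpace Ω] {μ : Measure Ω}

lemma Valid.coverage_perfect (hp : p.Valid) {c : Ω → p.Fading}
    (hc : p.IsSlotFading .perfect μ c) {s : Finset (Fin p.N)} {k : Fin p.N} (hk : k ∈ s)
    (m : Fin p.d) :
    μ.real {ω | p.τ ≤ p.sinrIA .perfect (c ω) s k m} = Real.exp (-(p.σ ^ 2 * p.τ / p.α)) := by
  have hα := hp.α_pos
  have hσ := hp.σ_pos
  have hτ := hp.τ_pos
  have h1 : {ω | p.τ ≤ p.sinrIA .perfect (c ω) s k m} =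
      {ω | p.σ ^ 2 * p.τ / p.α ≤ (c ω).1 s k m} := by
    ext ω
    simp only [sinrIA, Set.mem_ofPred_eq]
    rw [le_div_iff₀ (by positivity), div_le_iff₀ hα, mul_comm p.τ, mul_comm p.α]
  rw [h1, (hc.gain s k hk m).measureReal_eq (p := fun x => p.σ ^ 2 * p.τ / p.α ≤ x)
    measurableSet_Ici]
  exact expMeasure_real_Ici (by positivity)

/-- Given `v`, the probability is an exponential tail at the nonnegative level `φ v`. This is how a
threshold probability becomes a Laplace transform. -/
lemma measureReal_expMeasure_prod {β : Type*} [MeasurableSpace β] (ν : Measure β)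
    [IsProbabilityMeasure ν] {φ : β → ℝ} (hφ : Measurable φ) (h0 : ∀ v, 0 ≤ φ v) :
    ((expMeasure 1).prod ν).real {x | φ x.2 ≤ x.1} = ∫ v, Real.exp (-φ v) ∂ν := by
  have hP : IsProbabilityMeasure (expMeasure 1) := isProbabilityMeasure_expMeasure one_pos
  have hS : MeasurableSet {x : ℝ × β | φ x.2 ≤ x.1} :=
    measurableSet_le (hφ.comp measurable_snd) measurable_fst
  rw [← integral_indicator_one hS, integral_prod_symm _ (by
    exact (integrable_const (1 : ℝ)).indicator hS)]
  refine integral_congr_ae (Eventually.of_forall fun v => ?_)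
  simp only
  rw [← expMeasure_real_Ici (h0 v), ← integral_indicator_one measurableSet_Ici]
  rfl

/-- The threshold is reached when G ≥ σ²τ/α + τ d ∑ X_i Y_i. The exponential tail splits this sum
into a product, with one factor of mean `F` for each of the |s| - 1 interferers. -/
lemma Valid.coverage_imperfect (hp : p.Valid) (h3 : 3 ≤ p.Nt * p.Nr) {c : Ω → p.Fading}
    (hc : p.IsSlotFading .imperfect μ c) {s : Finset (Fin p.N)} {k : Fin p.N} (hk : k ∈ s)
    (m : Fin p.d) :
    μ.real {ω | p.τ ≤ p.sinrIA .imperfect (c ω) s k m} =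
      Real.exp (-(p.σ ^ 2 * p.τ / p.α)) * p.F ^ (s.card - 1) := by
  have hα := hp.α_pos
  have hσ := hp.σ_pos
  have hτ := hp.τ_pos
  have hd := hp.d_pos
  have hQ' : (0 : ℝ) < p.Q := by have := two_le_Q h3; exact_mod_cast (by omega : 0 < p.Q)
  have hP1 := isProbabilityMeasureBeta (hp.aBeta_pos h3) (hp.bBeta_pos h3)
  have hP2 := isProbabilityMeasure_gammaMeasure hQ' (δ_pos (p := p))
  let ι := {i : Fin p.N // i ∈ s ∧ i ≠ k}
  let ν := (gammaMeasure (p.Q : ℝ) p.δ).prod (betaMeasure p.aBeta p.bBeta)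
  -- The absolute values change nothing almost surely, since X, Y ≥ 0, and make `φ` nonnegative
  -- everywhere.
  let φ : (ι → ℝ × ℝ) → ℝ := fun v =>
    p.σ ^ 2 * p.τ / p.α + ∑ i, p.τ * p.d * |(v i).1 * (v i).2|
  have hφ : Measurable φ := by fun_prop
  have hφ0 : ∀ v, 0 ≤ φ v := fun v => by positivity
  have hlaw := hc.interference rfl s k hk m
  have hnn : ∀ᵐ v ∂(Measure.pi fun _ : ι => ν), ∀ i, 0 ≤ (v i).1 * (v i).2 := by
    have h0 : ∀ᵐ x ∂ν, 0 ≤ x.1 * x.2 := by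
      filter_upwards [Measure.quasiMeasurePreserving_fst.ae (ae_gammaMeasure_pos (p.Q : ℝ) p.δ),
        Measure.quasiMeasurePreserving_snd.ae (ae_betaMeasure_mem_Ioo p.aBeta p.bBeta)]
        with x hx hy
      exact mul_nonneg hx hy.1.le
    exact ae_all_iff.2 fun i =>
      (Measure.tendsto_eval_ae_ae (μ := fun _ : ι => ν) (i := i)).eventually h0
  have hnn' : ∀ᵐ ω ∂μ, ∀ i : ι, 0 ≤ ((c ω).2.1 s k m i).1 * ((c ω).2.1 s k m i).2 := by
    have h1 : ∀ᵐ x ∂(expMeasure 1).prod (Measure.pi fun _ : ι => ν),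
        ∀ i, 0 ≤ (x.2 i).1 * (x.2 i).2 := Measure.quasiMeasurePreserving_snd.ae hnn
    exact (hlaw.map_eq ▸ ae_of_ae_map hlaw.aemeasurable) h1
  have hset : ({ω | p.τ ≤ p.sinrIA .imperfect (c ω) s k m} : Set Ω) =ᵐ[μ]
      {ω | φ (fun i : ι => (c ω).2.1 s k m i) ≤ (c ω).1 s k m} := by
    filter_upwards [hnn'] with ω hω
    have hsum : ∑ i ∈ s.erase k, p.α * ((c ω).2.1 s k m i).1 * (p.d * ((c ω).2.1 s k m i).2) =
        p.α * p.d * ∑ i : ι, |((c ω).2.1 s k m i).1 * ((c ω).2.1 s k m i).2| := by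
      rw [Finset.mul_sum, ← Finset.sum_subtype (p := fun i => i ∈ s ∧ i ≠ k) (s.erase k)
        (fun i => by rw [Finset.mem_erase, and_comm])
        (fun i => p.α * p.d * |((c ω).2.1 s k m i).1 * ((c ω).2.1 s k m i).2|)]
      refine Finset.sum_congr rfl fun i hi => ?_
      rw [Finset.mem_erase] at hi
      rw [abs_of_nonneg (hω ⟨i, hi.2, hi.1⟩)]
      ring
    have hS : 0 ≤ ∑ i : ι, |((c ω).2.1 s k m i).1 * ((c ω).2.1 s k m i).2| :=
      Finset.sum_nonneg fun i _ => abs_nonneg _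
    refine propext ?_
    change p.τ ≤ p.sinrIA .imperfect (c ω) s k m ↔ _ ≤ (c ω).1 s k m
    simp only [sinrIA, φ]
    rw [hsum, le_div_iff₀ (by positivity), ← Finset.mul_sum,
      ← mul_le_mul_iff_right₀ hα (b := p.σ ^ 2 * p.τ / p.α + _)]
    refine iff_of_eq (congrArg (· ≤ _) ?_)
    rw [mul_add p.α, mul_div_cancel₀ _ hα.ne']
    ring
  rw [measureReal_congr hset, hlaw.measureReal_eq (p := fun x => φ x.2 ≤ x.1)
    (measurableSet_le (hφ.comp measurable_snd) measurable_fst),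
    measureReal_expMeasure_prod _ hφ hφ0]
  have hprod : ∀ v : ι → ℝ × ℝ, Real.exp (-φ v) = Real.exp (-(p.σ ^ 2 * p.τ / p.α)) *
      ∏ i, Real.exp (-(p.τ * p.d * |(v i).1 * (v i).2|)) := by
    intro v
    rw [← Real.exp_sum, ← Real.exp_add, Finset.sum_neg_distrib]
    congr 1
    simp only [φ]
    ring
  simp_rw [hprod]
  rw [integral_const_mul, integral_fintype_prod_eq_pow
    (fun x : ℝ × ℝ => Real.exp (-(p.τ * p.d * |x.1 * x.2|))), hp.F_eq_integral h3]
  congr 2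
  rw [← Finset.card_erase_of_mem hk, Fintype.card_subtype]
  congr 1
  ext i
  simp [and_comm]

/-- A Cauchy product. As `lagCoeff n l` vanishes for l > n, it is the full coefficient sequence of
the polynomial, and the convolution defining `kappa` needs no truncation. -/
lemma laguerre_sq (n : ℕ) (x : ℝ) :
    p.laguerre n x ^ 2 = ∑ j ∈ Finset.range (2 * n + 1), p.kappa n j * x ^ j := by
  let P : Polynomial ℝ := ∑ l ∈ Finset.range (n + 1), Polynomial.monomial l (p.lagCoeff n l)
  have hdeg : P.natDegree ≤ n :=
    Polynomial.natDegree_sum_le_of_forall_le _ _ fun l hl =>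
      (Polynomial.natDegree_monomial_le _).trans (by simpa [Nat.lt_succ_iff] using hl)
  have hcoeff : ∀ l, P.coeff l = p.lagCoeff n l := by
    intro l
    simp only [P, Polynomial.finsetSum_coeff, Polynomial.coeff_monomial]
    rw [Finset.sum_ite_eq']
    split_ifs with h
    · rfl
    · rw [Finset.mem_range, Nat.lt_succ_iff] at h
      simp [lagCoeff, h]
  have heval : P.eval x = p.laguerre n x := by
    simp [P, laguerre, Polynomial.eval_finsetSum]
  rw [← heval, ← Polynomial.eval_pow, sq, Polynomial.eval_eq_sum_range' (n := 2 * n + 1)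
    (lt_of_le_of_lt Polynomial.natDegree_mul_le (by omega))]
  refine Finset.sum_congr rfl fun j _ => ?_
  rw [Polynomial.coeff_mul, Finset.Nat.sum_antidiagonal_eq_sum_range_succ_mk]
  simp only [hcoeff, kappa]

lemma integrableOn_rpow_mul_exp_neg {s x : ℝ} (hs : 0 < s) (hx : 0 ≤ x) :
    IntegrableOn (fun t : ℝ => t ^ (s - 1) * Real.exp (-t)) (Set.Ioi x) := by
  refine ((Real.GammaIntegral_convergent hs).mono_set (Set.Ioi_subset_Ioi hx)).congr ?_
  exact Eventually.of_forall fun t => mul_comm _ _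

lemma eigenDensity_eq {x : ℝ} (hx : 0 ≤ x) :
    p.eigenDensity x = ∑ n ∈ Finset.range p.mi, p.Omega n *
      ∑ j ∈ Finset.range (2 * n + 1), p.kappa n j *
        (x ^ ((j : ℝ) + ((p.ma - p.mi : ℕ) : ℝ) + 1 - 1) * Real.exp (-x)) := by
  rw [eigenDensity, if_pos hx, Finset.mul_sum]
  refine Finset.sum_congr rfl fun n _ => ?_
  rw [laguerre_sq, Omega, Finset.mul_sum, Finset.mul_sum, Finset.sum_mul, Finset.sum_mul,
    Finset.mul_sum]
  refine Finset.sum_congr rfl fun j _ => ?_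
  rw [add_sub_cancel_right, ← Nat.cast_add, Real.rpow_natCast, pow_add]
  ring

lemma eigenDensity_nonneg (x : ℝ) : 0 ≤ p.eigenDensity x := by
  unfold eigenDensity
  split_ifs
  · exact mul_nonneg (by positivity) (Finset.sum_nonneg fun n _ => by positivity)
  · exact le_rfl

lemma measurable_eigenDensity : Measurable p.eigenDensity := by
  unfold eigenDensity laguerre
  exact Measurable.ite measurableSet_Ici (by fun_prop) measurable_const

lemma eigenLaw_real_Ici {x : ℝ} (hx : 0 ≤ x) :
    p.eigenLaw.real (Set.Ici x) = ∑ n ∈ Finset.range p.mi, p.Omega n *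
      ∑ j ∈ Finset.range (2 * n + 1), p.kappa n j *
        upperGamma ((j : ℝ) + ((p.ma - p.mi : ℕ) : ℝ) + 1) x := by
  rw [measureReal_def, eigenLaw, withDensity_apply _ measurableSet_Ici,
    ← integral_eq_lintegral_of_nonneg_ae (Eventually.of_forall eigenDensity_nonneg)
      measurable_eigenDensity.aestronglyMeasurable, integral_Ici_eq_integral_Ioi,
    setIntegral_congr_fun measurableSet_Ioi (fun t ht => eigenDensity_eq (hx.trans (le_of_lt ht)))]
  have hi : ∀ j : ℕ, IntegrableOn (fun t : ℝ =>
      t ^ ((j : ℝ) + ((p.ma - p.mi : ℕ) : ℝ) + 1 - 1) * Real.exp (-t)) (Set.Ioi x) := fun j =>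
    integrableOn_rpow_mul_exp_neg (by positivity) hx
  rw [integral_finsetSum _ fun n _ => Integrable.const_mul
    (integrable_finsetSum _ fun j _ => (hi j).const_mul _) _]
  refine Finset.sum_congr rfl fun n _ => ?_
  rw [integral_const_mul, integral_finsetSum _ fun j _ => (hi j).const_mul _]
  congr 1
  refine Finset.sum_congr rfl fun j _ => ?_
  rw [integral_const_mul, upperGamma]

lemma Valid.Nt_pos (hp : p.Valid) : 0 < p.Nt := by
  have := hp.one_le_d.trans (hp.d_le.trans (min_le_left _ _)); omega

lemma Valid.coverage_svd (hp : p.Valid) {b : Backhaul} {c : Ω → p.Fading}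
    (hc : p.IsSlotFading b μ c) (k : Fin p.N) (m : Fin p.d) :
    μ.real {ω | p.τ ≤ p.snrSVD (c ω) k m} =
      p.eigenLaw.real (Set.Ici (p.Nt * p.σ ^ 2 * p.τ / (p.ζ * p.P))) := by
  have hσ := hp.σ_pos
  have hζ := hp.ζ_pos
  have hP := hp.P_pos
  have hN : (0 : ℝ) < p.Nt := by exact_mod_cast hp.Nt_pos
  have h1 : {ω | p.τ ≤ p.snrSVD (c ω) k m} =
      {ω | p.Nt * p.σ ^ 2 * p.τ / (p.ζ * p.P) ≤ (c ω).2.2 k m} := by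
    ext ω
    simp only [snrSVD, Set.mem_ofPred_eq]
    rw [div_mul_eq_mul_div, le_div_iff₀ (by positivity), div_le_iff₀ (by positivity),
      mul_comm p.τ, mul_comm (p.ζ * p.P)]
  rw [h1, (hc.eigen k m).measureReal_eq
    (p := fun x => p.Nt * p.σ ^ 2 * p.τ / (p.ζ * p.P) ≤ x) measurableSet_Ici]
  rfl

lemma integral_mul_sum_ite [IsProbabilityMeasure μ] {f : Fin p.d → Ω → Prop} [∀ m ω, Decidable (f m ω)]
    (hf : ∀ m, MeasurableSet {ω | f m ω}) {x P : ℝ} (hP : ∀ m, μ.real {ω | f m ω} = P) :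
    ∫ ω, x * ∑ m : Fin p.d, (if f m ω then p.R else 0) ∂μ = x * p.d * p.R * P := by
  have h1 : ∀ m, (fun ω => if f m ω then p.R else 0) =
      {ω | f m ω}.indicator (fun _ => p.R) := by
    intro m; ext ω; simp [Set.indicator_apply]
  rw [integral_const_mul, integral_finsetSum _ fun m _ => by
    rw [h1]; exact (integrable_const _).indicator (hf m)]
  simp_rw [h1, integral_indicator_const _ (hf _), hP]
  simp
  ring

/-- The mean service is the rate of the decision. -/
lemma Valid.integral_service [IsProbabilityMeasure μ] (hp : p.Valid) {b : Backhaul}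
    (hb : b = .imperfect → 3 ≤ p.Nt * p.Nr) {c : Ω → p.Fading} (hc : p.IsSlotFading b μ c)
    (D : Decision p.N) (k : Fin p.N) :
    ∫ ω, p.service b (c ω) D k ∂μ = p.rate b D k := by
  cases D with
  | ia s =>
    simp only [service, rate]
    split_ifs with hk
    · have hms : ∀ m, MeasurableSet {ω | p.τ ≤ p.sinrIA b (c ω) s k m} := fun m =>
        measurableSet_le measurable_const ((measurable_sinrIA b s k m).comp hc.measurable)
      cases b with
      | imperfect =>
        rw [integral_mul_sum_ite hms (hp.coverage_imperfect (hb rfl) hc hk)]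
        simp only [iaRate, r]; ring
      | perfect =>
        rw [integral_mul_sum_ite hms (hp.coverage_perfect hc hk)]
        simp only [iaRate, mu]
    · simp
  | svd j =>
    simp only [service, rate]
    split_ifs with hk
    · have hms : ∀ m, MeasurableSet {ω | p.τ ≤ p.snrSVD (c ω) k m} := fun m =>
        measurableSet_le measurable_const ((measurable_snrSVD k m).comp hc.measurable)
      rw [integral_mul_sum_ite hms (hp.coverage_svd hc k), eigenLaw_real_Ici, rsvd]
      have hσ := hp.σ_pos
      have hζ := hp.ζ_pos
      have hP := hp.P_pos
      have hτ := hp.τ_pos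
      positivity
    · simp

end Coverage

end Params
-- Geometry of the rate region and monotonicity of the rates.
lemma le_bestInteger {f : ℕ → ℝ} {x : ℝ} {L : ℕ} (hL : bestInteger f x < L)
    (h : ⌈x⌉₊ ≤ L → f L ≤ f ⌈x⌉₊) : f L ≤ f (bestInteger f x) := by
  unfold bestInteger at hL ⊢
  split_ifs at hL ⊢ with h1
  · exact h hL.le
  -- When the floor wins, L > ⌊x⌋ still forces L ≥ ⌈x⌉, and f(⌈x⌉) < f(⌊x⌋).
  · exact (h ((Nat.ceil_le_floor_add_one x).trans hL)).trans (not_le.1 h1).le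

namespace Params

variable {p : Params}

lemma weight_eq (b : Backhaul) (q : Fin p.N → ℝ) (D : Decision p.N) :
    p.weight b q D = ∑ k, p.rate b D k * q k := by
  cases D with
  | ia s => simp [weight, rate, ite_mul, Finset.mul_sum, Finset.sum_ite_mem]
  | svd j => simp [weight, rate, ite_mul]

lemma rate_ia (b : Backhaul) (s : Finset (Fin p.N)) :
    p.rate b (.ia s) = p.iaRate b s.card • indVec s := by
  ext k; simp [rate, indVec]

lemma rate_svd (b : Backhaul) (j : Fin p.N) : p.rate b (.svd j) = p.rsvd • indVec {j} := by
  ext k; simp [rate, indVec]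

lemma rate_ia_empty (b : Backhaul) : p.rate b (.ia ∅) = 0 := by
  ext k; simp [rate]

/-- The points generating the region. -/
def vertices (p : Params) (b : Backhaul) : Set (Fin p.N → ℝ) :=
  {0} ∪ (⋃ L ∈ Finset.Icc 1 (p.Lmax b), p.iaPoints b L) ∪ p.J1

lemma mem_vertices {b : Backhaul} {x : Fin p.N → ℝ} : x ∈ p.vertices b ↔
    x = 0 ∨ (∃ s : Finset (Fin p.N), 1 ≤ s.card ∧ s.card ≤ p.Lmax b ∧ x = p.rate b (.ia s)) ∨
      ∃ j, x = p.rate b (.svd j) := by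
  simp only [vertices, iaPoints, J1, S, Set.mem_union, Set.mem_singleton_iff, Set.mem_iUnion,
    Finset.mem_Icc, Set.mem_ofPred_eq, or_assoc, rate_ia, rate_svd]
  refine or_congr_right (or_congr ⟨?_, ?_⟩ ⟨?_, ?_⟩)
  · rintro ⟨L, hL, _, ⟨s, rfl, rfl⟩, rfl⟩
    exact ⟨s, hL.1, hL.2, rfl⟩
  · rintro ⟨s, h1, h2, rfl⟩
    exact ⟨s.card, ⟨h1, h2⟩, _, ⟨s, rfl, rfl⟩, rfl⟩
  · rintro ⟨_, ⟨s, hs, rfl⟩, rfl⟩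
    obtain ⟨j, rfl⟩ := Finset.card_eq_one.1 hs
    exact ⟨j, rfl⟩
  · rintro ⟨j, rfl⟩
    exact ⟨_, ⟨{j}, by simp, rfl⟩, rfl⟩

lemma convex_region (b : Backhaul) : Convex ℝ (p.region b) := convex_closedConvexHull

lemma isClosed_region (b : Backhaul) : IsClosed (p.region b) := isClosed_closedConvexHull

lemma vertices_subset_region (b : Backhaul) : p.vertices b ⊆ p.region b :=
  subset_closedConvexHull

lemma zero_mem_region (b : Backhaul) : (0 : Fin p.N → ℝ) ∈ p.region b :=
  vertices_subset_region b (mem_vertices.2 (.inl rfl))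

lemma smul_mem_region {b : Backhaul} {x : Fin p.N → ℝ} (hx : x ∈ p.region b) {t : ℝ}
    (h0 : 0 ≤ t) (h1 : t ≤ 1) : t • x ∈ p.region b :=
  (convex_region b).smul_mem_of_zero_mem (zero_mem_region b) hx ⟨h0, h1⟩

/-- Linear functionals are maximized over the region by rates of decisions. -/
lemma sum_mul_le_of_mem_region {b : Backhaul} {x : Fin p.N → ℝ} (hx : x ∈ p.region b)
    (q : Fin p.N → ℝ) {w : ℝ} (hw : ∀ D, p.weight b q D ≤ w) : ∑ k, x k * q k ≤ w := by
  have hsub : p.region b ⊆ {x | ∑ k, x k * q k ≤ w} := by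
    refine closedConvexHull_min (fun x hx => ?_) ?_ ?_
    · have h : ∃ D, x = p.rate b D := by
        rcases mem_vertices.1 hx with rfl | ⟨s, -, -, rfl⟩ | ⟨j, rfl⟩
        · exact ⟨_, (rate_ia_empty b).symm⟩
        · exact ⟨_, rfl⟩
        · exact ⟨_, rfl⟩
      obtain ⟨D, rfl⟩ := h
      exact (weight_eq b q D).symm.le.trans (hw D)
    · refine convex_halfSpace_le ⟨fun x y => ?_, fun c x => ?_⟩ w
      · simp [add_mul, Finset.sum_add_distrib]
      · simp [mul_assoc, Finset.mul_sum]
    · exact isClosed_le (by fun_prop) continuous_const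
  exact hsub hx

/-- Monotonicity properties of the rate of interference alignment. -/
structure IARateRegular (p : Params) (b : Backhaul) : Prop where
  pos : ∀ L, 1 ≤ L → L ≤ p.N → 0 < p.iaRate b L
  anti : ∀ L, 1 ≤ L → L + 1 ≤ p.N → p.iaRate b (L + 1) ≤ p.iaRate b L
  unimodal : ∀ L, p.Lmax b < L → L ≤ p.N → L * p.iaRate b L ≤ p.Lmax b * p.iaRate b (p.Lmax b)

/-- The points with this property form a closed convex set, so vertices suffice. Switching pair k
off in an IA vertex leaves a vector with the smaller active set but the lower rate of the larger
one, hence a multiple in [0, 1] of another vertex (or 0). -/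
lemma update_mem_region {b : Backhaul} (h : p.IARateRegular b) {x : Fin p.N → ℝ}
    (hx : x ∈ p.region b) (k : Fin p.N) : Function.update x k 0 ∈ p.region b := by
  have hsub : p.region b ⊆ {x | Function.update x k 0 ∈ p.region b} := by
    refine closedConvexHull_min (fun x hx => ?_) ?_ ?_
    · change Function.update x k 0 ∈ p.region b
      have hself : x k = 0 → Function.update x k 0 ∈ p.region b := fun hk => by
        rw [← hk, Function.update_eq_self]; exact vertices_subset_region b hx
      rcases mem_vertices.1 hx with rfl | ⟨s, h1, h2, rfl⟩ | ⟨j, rfl⟩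
      · exact hself rfl
      · by_cases hk : k ∈ s
        · have hcard := Finset.card_erase_add_one hk
          have hsN : s.card ≤ p.N := by simpa using s.card_le_univ
          rcases Nat.eq_zero_or_pos (s.erase k).card with h0 | h0
          · convert! zero_mem_region b using 1
            ext i
            rw [Finset.card_eq_zero] at h0
            by_cases hi : i = k
            · simp [hi]
            · have : i ∉ s := fun his => by
                have : i ∈ s.erase k := Finset.mem_erase.2 ⟨hi, his⟩
                simp [h0] at this
              simp [hi, rate, this]
          · have hpos := h.pos _ h0 (by omega)
            have hmem : p.rate b (.ia (s.erase k)) ∈ p.region b :=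
              vertices_subset_region b (mem_vertices.2 (.inr (.inl ⟨_, h0, by omega, rfl⟩)))
            have hle : p.iaRate b s.card ≤ p.iaRate b (s.erase k).card := by
              rw [← hcard]; exact h.anti _ h0 (by omega)
            convert! smul_mem_region hmem (t := p.iaRate b s.card / p.iaRate b (s.erase k).card)
              (div_nonneg (h.pos _ h1 hsN).le hpos.le) ((div_le_one hpos).2 hle) using 1
            ext i
            by_cases hi : i = k
            · simp [hi, rate]
            · by_cases his : i ∈ s
              · simp [hi, his, rate, hpos.ne']
              · simp [hi, his, rate]
        · exact hself (by simp [rate, hk])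
      · by_cases hj : k = j
        · convert! zero_mem_region b using 1
          ext i
          by_cases hi : i = k
          · simp [hi]
          · simp [hi, rate, ← hj]
        · exact hself (by simp [rate, hj])
    · intro x hx y hy s t hs ht hst
      have := convex_region b hx hy hs ht hst
      change Function.update _ k 0 ∈ p.region b
      convert! this using 1
      ext i
      by_cases hi : i = k
      · simp [hi]
      · simp [hi]
    · exact (isClosed_region b).preimage (continuous_id.update k continuous_const)
  exact hsub hx

/-- The region is coordinate-convex. -/
lemma mem_region_of_le {b : Backhaul} (h : p.IARateRegular b) {x y : Fin p.N → ℝ}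
    (hx : x ∈ p.region b) (hy : ∀ k, 0 ≤ y k) (hyx : ∀ k, y k ≤ x k) : y ∈ p.region b := by
  have key : ∀ T : Finset (Fin p.N), (fun k => if k ∈ T then y k else x k) ∈ p.region b := by
    intro T
    induction T using Finset.induction_on with
    | empty => simpa using hx
    | insert k T hk ih =>
      -- For y k > 0 the point is a convex combination, with weight y k / x k, of the current point
      -- and its projection. The case y k = 0 is separate because x k may then vanish.
      rcases (hy k).eq_or_lt with h0 | h0
      · convert! update_mem_region h ih k using 1
        ext i
        by_cases hi : i = k
        · simp [hi, ← h0]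
        · simp [hi]
      · have hxk : 0 < x k := h0.trans_le (hyx k)
        have hr : y k / x k ≤ 1 := (div_le_one hxk).2 (hyx k)
        convert! convex_region b ih (update_mem_region h ih k) (div_nonneg h0.le hxk.le)
          (sub_nonneg.2 hr) (by ring) using 1
        ext i
        by_cases hi : i = k
        · subst hi; simp [hk, hxk.ne']
        · simp only [Finset.mem_insert, hi, false_or, Pi.add_apply, Pi.smul_apply, smul_eq_mul, ne_eq,
            not_false_eq_true, Function.update_of_ne]
          ring
  simpa using key Finset.univ

/-- A total rate g shared equally by L + 1 pairs is the uniform average of g shared equally by the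
L-subsets: each pair survives in L of the L + 1 deletions. -/
lemma smul_indVec_mem_region {b : Backhaul} {g : ℝ} {M : ℕ} (hM : 1 ≤ M)
    (h : ∀ s : Finset (Fin p.N), s.card = M → (g / M) • indVec s ∈ p.region b) (L : ℕ)
    (hL : M ≤ L) : ∀ s : Finset (Fin p.N), s.card = L → (g / L) • indVec s ∈ p.region b := by
  induction L, hL using Nat.le_induction with
  | base => exact h
  | succ L hL ih =>
    intro s hs
    have hL0 : (0 : ℝ) < L := by exact_mod_cast (by omega : 0 < L)
    have hmem := (convex_region b).sum_mem (t := s) (w := fun _ => ((L : ℝ) + 1)⁻¹)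
      (z := fun j => (g / L) • indVec (s.erase j)) (fun _ _ => by positivity)
      (by rw [Finset.sum_const, hs, nsmul_eq_mul]; push_cast; field_simp)
      (fun j hj => ih _ (by rw [Finset.card_erase_of_mem hj, hs]; rfl))
    convert! hmem using 1
    ext k
    rw [Finset.sum_apply]
    simp only [Pi.smul_apply, smul_eq_mul, indVec]
    rw [← Finset.mul_sum, ← Finset.mul_sum]
    by_cases hk : k ∈ s
    · have : ∑ j ∈ s, (if k ∈ s.erase j then (1 : ℝ) else 0) = L := by
        rw [← Finset.sum_filter, Finset.sum_const, nsmul_one]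
        congr 1
        have : s.filter (fun j => k ∈ s.erase j) = s.erase k := by
          ext j; simp [hk, and_comm, eq_comm]
        rw [this, Finset.card_erase_of_mem hk, hs]; rfl
      rw [this, if_pos hk]
      push_cast
      field_simp
    · have : ∑ j ∈ s, (if k ∈ s.erase j then (1 : ℝ) else 0) = 0 :=
        Finset.sum_eq_zero fun j _ => by simp [hk]
      rw [this, if_neg hk]
      simp

/-- Every rate vector, also with more than `L_I` (resp. `L_P`) active pairs, is in the region. -/
lemma rate_mem_region {b : Backhaul} (h : p.IARateRegular b) (D : Decision p.N) :
    p.rate b D ∈ p.region b := by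
  cases D with
  | svd j => exact vertices_subset_region b (mem_vertices.2 (.inr (.inr ⟨j, rfl⟩)))
  | ia s =>
    have hsN : s.card ≤ p.N := by simpa using s.card_le_univ
    rcases Nat.eq_zero_or_pos s.card with h0 | h0
    · rw [Finset.card_eq_zero.1 h0, rate_ia_empty]; exact zero_mem_region b
    rcases le_or_gt s.card (p.Lmax b) with h1 | h1
    · exact vertices_subset_region b (mem_vertices.2 (.inr (.inl ⟨s, h0, h1, rfl⟩)))
    · have hu := h.unimodal _ h1 hsN
      have hs0 : (0 : ℝ) < s.card := by exact_mod_cast h0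
      have hpos := mul_pos hs0 (h.pos _ h0 hsN)
      -- If the best size were 0, unimodality would bound a positive total rate by 0.
      have hM : 1 ≤ p.Lmax b := by
        by_contra hM
        have : p.Lmax b = 0 := by omega
        rw [this] at hu
        simp only [Nat.cast_zero, zero_mul] at hu
        exact absurd hu (not_le.2 hpos)
      have hM0 : (0 : ℝ) < p.Lmax b := by exact_mod_cast hM
      -- Here g is the total rate at the best size. Shared among the pairs of `s`, it gives each at
      -- least its actual rate.
      have hmem := smul_indVec_mem_region (b := b) (g := p.Lmax b * p.iaRate b (p.Lmax b)) hM
        (fun t ht => by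
          rw [mul_div_cancel_left₀ _ hM0.ne', ← ht, ← rate_ia]
          exact vertices_subset_region b
            (mem_vertices.2 (.inr (.inl ⟨t, by omega, by omega, rfl⟩)))) s.card h1.le s rfl
      refine mem_region_of_le h hmem (fun k => ?_) fun k => ?_
      · simp only [rate]
        split_ifs
        · exact (h.pos _ h0 hsN).le
        · exact le_rfl
      · simp only [rate, indVec, Pi.smul_apply, smul_eq_mul]
        split_ifs
        · rw [mul_one, le_div_iff₀ hs0, mul_comm]; exact hu
        · simp

lemma Valid.natCast_mul_θ_lt (hp : p.Valid) {L : ℕ} (hL : L ≤ p.N) : (L : ℝ) * p.θ < 1 := by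
  have : (L : ℝ) ≤ p.N := by exact_mod_cast hL
  nlinarith [hp.Nθ_lt, hp.θ_pos]

lemma Valid.regular_perfect (hp : p.Valid) : p.IARateRegular .perfect := by
  have hd := hp.d_pos
  have hR := hp.R_pos
  have hθ := hp.θ_pos
  set C := p.d * p.R * Real.exp (-(p.σ ^ 2 * p.τ / p.α)) with hC
  have hC0 : 0 < C := by positivity
  have hmu : ∀ L, p.mu L = (1 - L * p.θ) * C := fun L => by rw [mu, hC]; ring
  refine ⟨fun L _ hL => ?_, fun L _ hL => ?_, fun L hlt hL => ?_⟩
  · have := hp.natCast_mul_θ_lt hL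
    simp only [iaRate, hmu]
    exact mul_pos (by linarith) hC0
  · simp only [iaRate, hmu]
    refine mul_le_mul_of_nonneg_right ?_ hC0.le
    push_cast
    linarith
  · refine le_bestInteger (f := fun L => (L : ℝ) * p.mu L) hlt fun hc => ?_
    simp only [hmu]
    have h1 : 1 / (2 * p.θ) ≤ (⌈1 / (2 * p.θ)⌉₊ : ℝ) := Nat.le_ceil _
    have h2 : (⌈1 / (2 * p.θ)⌉₊ : ℝ) ≤ L := by exact_mod_cast hc
    generalize (⌈1 / (2 * p.θ)⌉₊ : ℝ) = a at h1 h2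
    rw [div_le_iff₀ (by positivity)] at h1
    rw [← mul_assoc (L : ℝ), ← mul_assoc a]
    refine mul_le_mul_of_nonneg_right ?_ hC0.le
    -- The difference a(1 - aθ) - L(1 - Lθ) factors as (L - a)(θ(a + L) - 1), and both a and L are
    -- at least 1/(2θ).
    have h3 : 1 ≤ p.θ * (a + L) := by nlinarith
    nlinarith [mul_nonneg (sub_nonneg.2 h2) (sub_nonneg.2 h3)]

/-- As 4/(θ l) < 0, the root is smaller than 1/θ - 2/l. Positivity ensures ⌈L₀⌉ ≥ 1, so the
truncated exponent L - 1 in `r` agrees with the real one at that integer. -/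
lemma L0_pos {θ l : ℝ} (hθ : 0 < θ) (hl : l < 0) :
    0 < (1 / θ - 2 / l - Real.sqrt ((2 / l - 1 / θ) ^ 2 + 4 / (θ * l))) / 2 := by
  have hθ' : 0 < 1 / θ := by positivity
  have hl' : 1 / l < 0 := one_div_neg.2 hl
  have h1 : 4 / (θ * l) = 4 * (1 / θ) * (1 / l) := by field_simp
  have h2 : 2 / l = 2 * (1 / l) := by ring
  have : Real.sqrt ((2 / l - 1 / θ) ^ 2 + 4 / (θ * l)) < 1 / θ - 2 / l := by
    rw [Real.sqrt_lt' (by rw [h2]; linarith), h1, h2]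
    nlinarith [mul_neg_of_pos_of_neg hθ' hl']
  linarith

/-- `x ↦ x (1 - θ x) e^{l (x - 1)}` decreases from its smaller critical point up to `1 / θ`. -/
lemma antitoneOn_total_rate {θ l : ℝ} (hθ : 0 < θ) (hl : l < 0) :
    AntitoneOn (fun x : ℝ => x * (1 - x * θ) * Real.exp (l * (x - 1)))
      (Set.Icc ((1 / θ - 2 / l - Real.sqrt ((2 / l - 1 / θ) ^ 2 + 4 / (θ * l))) / 2) (1 / θ)) := by
  have hder : ∀ x : ℝ, HasDerivAt (fun x : ℝ => x * (1 - x * θ) * Real.exp (l * (x - 1)))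
      ((1 - 2 * θ * x + l * x * (1 - θ * x)) * Real.exp (l * (x - 1))) x := by
    intro x
    have h1 : HasDerivAt (fun x : ℝ => x * (1 - x * θ)) (1 * (1 - x * θ) + x * (-(1 * θ))) x :=
      (hasDerivAt_id x).mul (((hasDerivAt_id x).mul_const θ).const_sub 1)
    have h2 : HasDerivAt (fun x : ℝ => Real.exp (l * (x - 1)))
        (Real.exp (l * (x - 1)) * (l * 1)) x :=
      (((hasDerivAt_id x).sub_const 1).const_mul l).exp
    convert! h1.mul h2 using 1
    ring
  refine antitoneOn_of_deriv_nonpos (convex_Icc _ _)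
    (fun x _ => (hder x).continuousAt.continuousWithinAt)
    (fun x _ => (hder x).differentiableAt.differentiableWithinAt) fun x hx => ?_
  rw [interior_Icc] at hx
  rw [(hder x).deriv]
  refine mul_nonpos_of_nonpos_of_nonneg ?_ (Real.exp_pos _).le
  have hl' : 1 / l < 0 := one_div_neg.2 hl
  have hθ' : 0 < 1 / θ := by positivity
  set S := Real.sqrt ((2 / l - 1 / θ) ^ 2 + 4 / (θ * l)) with hS
  -- The cross terms cancel, so the radicand is a sum of squares and S ≥ 1/θ; hence the larger
  -- critical point lies beyond 1/θ.
  have hrad : (2 / l - 1 / θ) ^ 2 + 4 / (θ * l) = (1 / θ) ^ 2 + (2 / l) ^ 2 := by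
    have := hl.ne; field_simp; ring
  have hS2 : S ^ 2 = (1 / θ) ^ 2 + (2 / l) ^ 2 := by
    rw [hS, hrad, Real.sq_sqrt (by positivity)]
  have hSθ : 1 / θ ≤ S := by
    rw [hS, hrad]
    exact Real.le_sqrt_of_sq_le (by nlinarith [sq_nonneg (2 / l)])
  have h2 : 2 / l = 2 * (1 / l) := by ring
  have ha : -(S / 2) ≤ x - (1 / θ - 2 / l) / 2 := by linarith [hx.1]
  have hb : x - (1 / θ - 2 / l) / 2 ≤ S / 2 := by linarith [hx.2]
  have hsq : (x - (1 / θ - 2 / l) / 2) ^ 2 ≤ (S / 2) ^ 2 := sq_le_sq' ha hb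
  -- The polynomial factor of the derivative has leading coefficient -lθ > 0 and roots (1/θ - 2/l)/2
  -- ± S/2, so it is nonpositive between them.
  have hid : 1 - 2 * θ * x + l * x * (1 - θ * x) =
      (-l * θ) * ((x - (1 / θ - 2 / l) / 2) ^ 2 - (S / 2) ^ 2) := by
    rw [div_pow S, hS2]
    have := hl.ne
    field_simp
    ring
  rw [hid]
  exact mul_nonpos_of_nonneg_of_nonpos (mul_nonneg (by linarith) hθ.le) (by linarith)

lemma Valid.regular_imperfect (hp : p.Valid) (h3 : 3 ≤ p.Nt * p.Nr) :
    p.IARateRegular .imperfect := by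
  have hd := hp.d_pos
  have hR := hp.R_pos
  have hθ := hp.θ_pos
  obtain ⟨hF0, hF1⟩ := hp.F_mem_Ioo h3
  set C := p.d * p.R * Real.exp (-(p.σ ^ 2 * p.τ / p.α)) with hC
  have hC0 : 0 < C := by positivity
  have hr : ∀ L, p.r L = (1 - L * p.θ) * p.F ^ (L - 1) * C := fun L => by rw [r, hC]; ring
  have hl : Real.log p.F < 0 := Real.log_neg hF0 hF1
  refine ⟨fun L _ hL => ?_, fun L hL1 hL => ?_, fun L hlt hL => ?_⟩
  · have := hp.natCast_mul_θ_lt hL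
    simp only [iaRate, hr]
    exact mul_pos (mul_pos (by linarith) (pow_pos hF0 _)) hC0
  · have := hp.natCast_mul_θ_lt hL
    simp only [iaRate, hr]
    refine mul_le_mul_of_nonneg_right ?_ hC0.le
    refine mul_le_mul ?_ (pow_le_pow_of_le_one hF0.le hF1.le (by omega)) (pow_pos hF0 _).le ?_
    · push_cast; linarith
    · push_cast at this; linarith
  · refine le_bestInteger (f := fun L => (L : ℝ) * p.r L) hlt fun hc => ?_
    have hexp : ∀ n : ℕ, 1 ≤ n → (n : ℝ) * p.r n =
        n * (1 - n * p.θ) * Real.exp (Real.log p.F * (n - 1)) * C := by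
      intro n hn
      rw [hr, Real.exp_mul, Real.exp_log hF0, ← Nat.cast_one, ← Nat.cast_sub hn,
        Real.rpow_natCast]
      ring
    have hpos : 0 < p.L0 := L0_pos hθ hl
    have hceil : 1 ≤ ⌈p.L0⌉₊ := Nat.ceil_pos.2 hpos
    have h1 : p.L0 ≤ (⌈p.L0⌉₊ : ℝ) := Nat.le_ceil _
    have h2 : (⌈p.L0⌉₊ : ℝ) ≤ L := by exact_mod_cast hc
    have h4 : (L : ℝ) ≤ 1 / p.θ := by
      rw [le_div_iff₀ hθ]; exact (hp.natCast_mul_θ_lt hL).le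
    rw [hexp _ hceil, hexp L (hceil.trans hc)]
    exact mul_le_mul_of_nonneg_right
      (antitoneOn_total_rate hθ hl ⟨h1, h2.trans h4⟩ ⟨h1.trans h2, h4⟩ h2) hC0.le

end Params
-- The queue process: measurability, independence, integrability.
noncomputable instance (N : ℕ) : Fintype (Decision N) :=
  Fintype.ofEquiv (Finset (Fin N) ⊕ Fin N)
    { toFun := Sum.elim Decision.ia Decision.svd
      invFun := fun D => match D with
        | .ia s => .inl s
        | .svd j => .inr j
      left_inv := by rintro (s | j) <;> rfl
      right_inv := by rintro (s | j) <;> rfl }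

/-- Separates the variables: after this finite sum every term is a function of the queues times a
quantity attached to a fixed decision. -/
lemma Policy.apply_eq_sum {N : ℕ} (π : Policy N) (f : Decision N → ℝ) (x : Fin N → ℝ) :
    f (π x) = ∑ D, {y | π y = D}.indicator 1 x * f D := by
  classical
  rw [Finset.sum_eq_single (π x)]
  · simp
  · intro D _ hD
    rw [Set.indicator_of_notMem (fun h => hD h.symm), zero_mul]
  · simp

lemma Policy.IsMeasurable.measurable_indicator {N : ℕ} {π : Policy N} (hπ : π.IsMeasurable)
    (D : Decision N) : Measurable ({y | π y = D}.indicator (1 : (Fin N → ℝ) → ℝ)) :=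
  measurable_one.indicator (hπ D)

variable {Ω : Type*} [MeasurableSpace Ω]

/-- A network with arrivals, run under a measurable policy. -/
structure Network (p : Params) (b : Backhaul) (μ : Measure Ω) (c : ℕ → Ω → p.Fading)
    (a : Fin p.N → ℝ) (A : ℕ → Ω → Fin p.N → ℝ) (π : Policy p.N) (q₀ : Fin p.N → ℝ) : Prop where
  valid : p.Valid
  antennas : b = .imperfect → 3 ≤ p.Nt * p.Nr
  fading : ∀ t, p.IsSlotFading b μ (c t)
  arrival : p.IsArrival μ c a A
  policy : π.IsMeasurable
  init : ∀ k, 0 ≤ q₀ k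

namespace Network

variable {p : Params} {b : Backhaul} {μ : Measure Ω} {c : ℕ → Ω → p.Fading}
  {a : Fin p.N → ℝ} {A : ℕ → Ω → Fin p.N → ℝ} {π : Policy p.N} {q₀ : Fin p.N → ℝ}

lemma measurable_slot (h : Network p b μ c a A π q₀) (t : ℕ) :
    Measurable fun ω => (A t ω, c t ω) :=
  (h.arrival.measurable t).prodMk (h.fading t).measurable

/-- The strict bound s < t is the point: it makes the queues at time t independent of slot t. -/
lemma measurable_past (h : Network p b μ c a A π q₀) (t : ℕ) :
    Measurable[⨆ s ∈ Set.Iio t, MeasurableSpace.comap (fun ω => (A s ω, c s ω)) inferInstance]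
      (p.queue b c π A q₀ t) := by
  induction t with
  | zero => exact @measurable_const _ _ _ (_) q₀
  | succ t ih =>
    set m : ℕ → MeasurableSpace Ω := fun s =>
      MeasurableSpace.comap (fun ω => (A s ω, c s ω)) inferInstance with hm
    have hq : Measurable[⨆ s ∈ Set.Iio (t + 1), m s] (p.queue b c π A q₀ t) :=
      ih.mono (biSup_mono fun s hs => lt_trans (Set.mem_Iio.1 hs) (Nat.lt_succ_self t)) le_rfl
    have hs : Measurable[⨆ s ∈ Set.Iio (t + 1), m s] fun ω => (A t ω, c t ω) :=
      (comap_measurable _).mono (le_biSup m (Set.mem_Iio.2 (Nat.lt_succ_self t))) le_rfl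
    have hstep : Measurable fun z : (Fin p.N → ℝ) × ((Fin p.N → ℝ) × p.Fading) => fun k =>
        max (z.1 k - p.service b z.2.2 (π z.1) k) 0 + z.2.1 k := by
      refine measurable_pi_lambda _ fun k => ?_
      have h1 : Measurable fun z : (Fin p.N → ℝ) × ((Fin p.N → ℝ) × p.Fading) =>
          p.service b z.2.2 (π z.1) k := by
        simp_rw [fun z : (Fin p.N → ℝ) × ((Fin p.N → ℝ) × p.Fading) =>
          π.apply_eq_sum (fun D => p.service b z.2.2 D k) z.1]
        exact Finset.measurable_fun_sum _ fun D _ =>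
          ((h.policy.measurable_indicator D).comp measurable_fst).mul
            ((Params.measurable_service b D k).comp (measurable_snd.comp measurable_snd))
      fun_prop
    exact hstep.comp (hq.prodMk hs)

lemma measurable_queue (h : Network p b μ c a A π q₀) (t : ℕ) :
    Measurable (p.queue b c π A q₀ t) :=
  (h.measurable_past t).mono
    (iSup₂_le fun s _ => (h.measurable_slot s).comap_le) le_rfl

lemma indepFun_queue (h : Network p b μ c a A π q₀) (t : ℕ) :
    IndepFun (p.queue b c π A q₀ t) (fun ω => (A t ω, c t ω)) μ := by
  rw [IndepFun_iff_Indep]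
  have := indep_iSup_of_disjoint (S := Set.Iio t) (T := {t})
    (fun s => (h.measurable_slot s).comap_le) h.arrival.slots (by simp)
  refine indep_of_indep_of_le_left (indep_of_indep_of_le_right this ?_)
    (h.measurable_past t).comap_le
  exact le_biSup (fun s => MeasurableSpace.comap (fun ω => (A s ω, c s ω)) inferInstance)
    (Set.mem_singleton t)

/-- Uniform bounds on arrivals, and on the queues at each time. -/
lemma exists_bound [IsProbabilityMeasure μ] (h : Network p b μ c a A π q₀) :
    ∃ K : ℝ, 0 ≤ K ∧ ∀ᵐ ω ∂μ, ∀ (t : ℕ) (k : Fin p.N), A t ω k ∈ Set.Icc 0 K ∧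
      p.queue b c π A q₀ t ω k ∈ Set.Icc 0 (K * (t + 1)) := by
  obtain ⟨M, hM⟩ := h.arrival.bounded
  -- Adding the initial backlog makes the bound K (t + 1) hold already at t = 0.
  let K := max M 0 + ∑ k, q₀ k
  have hS : ∀ k, q₀ k ≤ ∑ k, q₀ k := fun k =>
    Finset.single_le_sum (f := q₀) (fun i _ => h.init i) (Finset.mem_univ k)
  have hS0 : 0 ≤ ∑ k, q₀ k := Finset.sum_nonneg fun k _ => h.init k
  have hK : 0 ≤ K := add_nonneg (le_max_right _ _) hS0
  refine ⟨K, hK, ?_⟩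
  filter_upwards [ae_all_iff.2 fun t => ae_all_iff.2 fun k => hM t k] with ω hω
  have hA : ∀ t k, A t ω k ∈ Set.Icc 0 K := fun t k =>
    ⟨(hω t k).1, (hω t k).2.le.trans ((le_max_left _ _).trans (le_add_of_nonneg_right hS0))⟩
  have hq : ∀ (t : ℕ) (k : Fin p.N), p.queue b c π A q₀ t ω k ∈ Set.Icc 0 (K * (t + 1)) := by
    intro t
    induction t with
    | zero =>
      intro k
      refine ⟨h.init k, ?_⟩
      simp only [Params.queue, Nat.cast_zero, zero_add, mul_one]
      exact (hS k).trans (le_add_of_nonneg_left (le_max_right _ _))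
    | succ t ih =>
      intro k
      simp only [Params.queue]
      have hB := h.valid.service_mem_Icc b (c t ω) (π (p.queue b c π A q₀ t ω)) k
      refine ⟨add_nonneg (le_max_right _ _) (hA t k).1, ?_⟩
      have : max (p.queue b c π A q₀ t ω k
          - p.service b (c t ω) (π (p.queue b c π A q₀ t ω)) k) 0 ≤ K * (t + 1) :=
        max_le (by linarith [(ih k).2, hB.1]) (by positivity)
      push_cast
      linarith [(hA t k).2]
  exact fun t k => ⟨hA t k, hq t k⟩

lemma integral_mul_of_slot (h : Network p b μ c a A π q₀) (t : ℕ) {g : (Fin p.N → ℝ) → ℝ}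
    (hg : Measurable g) {f : (Fin p.N → ℝ) × p.Fading → ℝ} (hf : Measurable f) :
    ∫ ω, g (p.queue b c π A q₀ t ω) * f (A t ω, c t ω) ∂μ =
      (∫ ω, g (p.queue b c π A q₀ t ω) ∂μ) * ∫ ω, f (A t ω, c t ω) ∂μ :=
  ((h.indepFun_queue t).comp hg hf).integral_fun_mul_eq_mul_integral
    (hg.comp (h.measurable_queue t)).aestronglyMeasurable
    (hf.comp (h.measurable_slot t)).aestronglyMeasurable

lemma integral_queue_mul_arrival (h : Network p b μ c a A π q₀) (t : ℕ) (k : Fin p.N) :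
    ∫ ω, p.queue b c π A q₀ t ω k * A t ω k ∂μ = ∫ ω, p.queue b c π A q₀ t ω k * a k ∂μ := by
  rw [integral_mul_const, ← h.arrival.mean t k]
  exact h.integral_mul_of_slot t (measurable_pi_apply k)
    ((measurable_pi_apply k).comp measurable_fst)

section Expectation

variable [IsProbabilityMeasure μ]

lemma ae_queue_nonneg (h : Network p b μ c a A π q₀) (t : ℕ) :
    ∀ᵐ ω ∂μ, ∀ k, 0 ≤ p.queue b c π A q₀ t ω k := by
  obtain ⟨K, -, hK⟩ := h.exists_bound
  exact hK.mono fun ω hω k => (hω t k).2.1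

lemma integrable_queue (h : Network p b μ c a A π q₀) (t : ℕ) (k : Fin p.N) :
    Integrable (fun ω => p.queue b c π A q₀ t ω k) μ := by
  obtain ⟨K, -, hK⟩ := h.exists_bound
  refine Integrable.of_bound ((measurable_pi_apply k).comp
    (h.measurable_queue t)).aestronglyMeasurable (K * (t + 1)) (hK.mono fun ω hω => ?_)
  rw [Real.norm_eq_abs, abs_of_nonneg (hω t k).2.1]
  exact (hω t k).2.2

lemma integrable_queue_sq (h : Network p b μ c a A π q₀) (t : ℕ) (k : Fin p.N) :
    Integrable (fun ω => p.queue b c π A q₀ t ω k ^ 2) μ := by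
  obtain ⟨K, -, hK⟩ := h.exists_bound
  refine Integrable.of_bound (((measurable_pi_apply k).comp
    (h.measurable_queue t)).pow_const 2).aestronglyMeasurable ((K * (t + 1)) ^ 2)
    (hK.mono fun ω hω => ?_)
  rw [Real.norm_eq_abs, abs_of_nonneg (sq_nonneg _)]
  exact pow_le_pow_left₀ (hω t k).2.1 (hω t k).2.2 2

lemma integrable_arrival (h : Network p b μ c a A π q₀) (t : ℕ) (k : Fin p.N) :
    Integrable (fun ω => A t ω k) μ := by
  obtain ⟨K, -, hK⟩ := h.exists_bound
  refine Integrable.of_bound ((measurable_pi_apply k).comp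
    (h.arrival.measurable t)).aestronglyMeasurable K (hK.mono fun ω hω => ?_)
  rw [Real.norm_eq_abs, abs_of_nonneg (hω t k).1.1]
  exact (hω t k).1.2

lemma integrable_service (h : Network p b μ c a A π q₀) (t : ℕ) (D : Decision p.N)
    (k : Fin p.N) : Integrable (fun ω => p.service b (c t ω) D k) μ := by
  refine Integrable.of_bound ((Params.measurable_service b D k).comp
    (h.fading t).measurable).aestronglyMeasurable (p.d * p.R) (Eventually.of_forall fun ω => ?_)
  have := h.valid.service_mem_Icc b (c t ω) D k
  rw [Real.norm_eq_abs, abs_of_nonneg this.1]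
  exact this.2

lemma rate_nonneg (h : Network p b μ c a A π q₀) (D : Decision p.N) (k : Fin p.N) :
    0 ≤ p.rate b D k := by
  rw [← h.valid.integral_service h.antennas (h.fading 0) D k]
  exact integral_nonneg fun ω => (h.valid.service_mem_Icc b (c 0 ω) D k).1

/-- Given the queues, the service may be replaced by its mean. -/
lemma integrable_and_integral_mul_service (h : Network p b μ c a A π q₀) (t : ℕ)
    {g : (Fin p.N → ℝ) → ℝ} (hg : Measurable g)
    (hgi : Integrable (fun ω => g (p.queue b c π A q₀ t ω)) μ) (k : Fin p.N) :
    Integrable (fun ω => g (p.queue b c π A q₀ t ω) *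
      p.service b (c t ω) (π (p.queue b c π A q₀ t ω)) k) μ ∧
    Integrable (fun ω => g (p.queue b c π A q₀ t ω) * p.rate b (π (p.queue b c π A q₀ t ω)) k) μ ∧
    ∫ ω, g (p.queue b c π A q₀ t ω) * p.service b (c t ω) (π (p.queue b c π A q₀ t ω)) k ∂μ =
      ∫ ω, g (p.queue b c π A q₀ t ω) * p.rate b (π (p.queue b c π A q₀ t ω)) k ∂μ := by
  have hgD : ∀ D, Measurable fun x => g x * {y | π y = D}.indicator (1 : (Fin p.N → ℝ) → ℝ) x :=
    fun D => hg.mul (h.policy.measurable_indicator D)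
  have hgDi : ∀ D, Integrable (fun ω => g (p.queue b c π A q₀ t ω) *
      {y | π y = D}.indicator (1 : (Fin p.N → ℝ) → ℝ) (p.queue b c π A q₀ t ω)) μ := fun D => by
    refine hgi.mul_bdd (c := 1) ((h.policy.measurable_indicator D).comp
      (h.measurable_queue t)).aestronglyMeasurable (Eventually.of_forall fun ω => ?_)
    by_cases hD : π (p.queue b c π A q₀ t ω) = D <;> simp [hD]
  -- Split over the decision taken. Each term is a function of the queues at time t times the
  -- service of a fixed decision in slot t, so independence factors its expectation.
  have h1 : ∀ ω, g (p.queue b c π A q₀ t ω) *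
      p.service b (c t ω) (π (p.queue b c π A q₀ t ω)) k = ∑ D, g (p.queue b c π A q₀ t ω) *
        {y | π y = D}.indicator (1 : (Fin p.N → ℝ) → ℝ) (p.queue b c π A q₀ t ω) *
          p.service b (c t ω) D k := fun ω => by
    rw [π.apply_eq_sum (fun D => p.service b (c t ω) D k), Finset.mul_sum]
    simp_rw [mul_assoc]
  have h2 : ∀ ω, g (p.queue b c π A q₀ t ω) *
      p.rate b (π (p.queue b c π A q₀ t ω)) k = ∑ D, g (p.queue b c π A q₀ t ω) *
        {y | π y = D}.indicator (1 : (Fin p.N → ℝ) → ℝ) (p.queue b c π A q₀ t ω) *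
          p.rate b D k := fun ω => by
    rw [π.apply_eq_sum (fun D => p.rate b D k), Finset.mul_sum]
    simp_rw [mul_assoc]
  simp_rw [h1, h2]
  have hi1 : ∀ D, Integrable (fun ω => g (p.queue b c π A q₀ t ω) *
      {y | π y = D}.indicator (1 : (Fin p.N → ℝ) → ℝ) (p.queue b c π A q₀ t ω) *
        p.service b (c t ω) D k) μ := fun D => by
    refine (hgDi D).mul_bdd (c := p.d * p.R) (h.integrable_service t D k).aestronglyMeasurable
      (Eventually.of_forall fun ω => ?_)
    have := h.valid.service_mem_Icc b (c t ω) D k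
    rw [Real.norm_eq_abs, abs_of_nonneg this.1]
    exact this.2
  refine ⟨integrable_finsetSum _ fun D _ => hi1 D,
    integrable_finsetSum _ fun D _ => (hgDi D).mul_const _, ?_⟩
  rw [integral_finsetSum _ fun D _ => hi1 D,
    integral_finsetSum _ fun D _ => (hgDi D).mul_const _]
  refine Finset.sum_congr rfl fun D _ => ?_
  rw [integral_mul_const, ← h.valid.integral_service h.antennas (h.fading t) D k]
  exact h.integral_mul_of_slot t (hgD D) ((Params.measurable_service b D k).comp measurable_snd)

end Expectation

end Network
-- Lyapunov drift, stability inside the region, and the converse.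
variable {Ω : Type*} [MeasurableSpace Ω]

lemma iIndepFun_fun_const {ι : Type*} {β : ι → Type*} {m : ∀ i, MeasurableSpace (β i)}
    (μ : Measure Ω) [IsProbabilityMeasure μ] (x : ∀ i, β i) :
    iIndepFun (fun i (_ : Ω) => x i) μ := by
  rw [iIndepFun_iff_measure_inter_preimage_eq_mul]
  intro S sets _
  by_cases h : ∀ i ∈ S, x i ∈ sets i
  · have h1 : ∀ i ∈ S, (fun _ : Ω => x i) ⁻¹' sets i = Set.univ := fun i hi =>
      Set.preimage_const_of_mem (h i hi)
    rw [Set.iInter₂_congr h1, Finset.prod_congr rfl fun i hi => by rw [h1 i hi]]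
    simp
  · push Not at h
    obtain ⟨i, hi, hx⟩ := h
    have h1 : (fun _ : Ω => x i) ⁻¹' sets i = ∅ := Set.preimage_const_of_notMem hx
    rw [Finset.prod_eq_zero hi (by rw [h1, measure_empty])]
    exact measure_mono_null (Set.biInter_subset_of_mem hi) (by rw [h1, measure_empty])

/-- Membership in the stability region quantifies over all arrival processes; this one shows that
the condition is never vacuous, so the converse applies to it. -/
lemma Params.isArrival_const {p : Params} {μ : Measure Ω} [IsProbabilityMeasure μ]
    {c : ℕ → Ω → p.Fading} (hslots : iIndepFun c μ) {a : Fin p.N → ℝ} (ha : ∀ k, 0 ≤ a k) :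
    p.IsArrival μ c a (fun _ _ => a) where
  measurable _ := measurable_const
  bounded := ⟨∑ k, a k + 1, fun _ k => Eventually.of_forall fun _ => ⟨ha k, by
    have := Finset.single_le_sum (f := a) (fun i _ => ha i) (Finset.mem_univ k)
    linarith⟩⟩
  users _ := iIndepFun_fun_const μ a
  ident _ k := IdentDistrib.refl aemeasurable_const
  mean _ k := by simp
  slots := hslots.comp (fun _ x => (a, x)) fun _ => measurable_const.prodMk measurable_id

/-- A bounded running average forces small terms infinitely often. -/
lemma exists_mem_Ico_le_of_sum_le {g : ℕ → ℝ} (hg : ∀ t, 0 ≤ g t) {M : ℝ} {n : ℕ} (hn : 1 ≤ n)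
    (h : ∑ t ∈ Finset.range (2 * n), g t ≤ M * (2 * n : ℕ)) :
    ∃ t, n ≤ t ∧ g t ≤ 2 * M := by
  by_contra! hc
  have h1 : ∑ t ∈ Finset.Ico n (2 * n), (2 * M) < ∑ t ∈ Finset.Ico n (2 * n), g t :=
    Finset.sum_lt_sum_of_nonempty (Finset.nonempty_Ico.2 (by omega)) fun t ht =>
      hc t (Finset.mem_Ico.1 ht).1
  have h2 : ∑ t ∈ Finset.Ico n (2 * n), g t ≤ ∑ t ∈ Finset.range (2 * n), g t :=
    Finset.sum_le_sum_of_subset_of_nonneg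
      (fun t ht => Finset.mem_range.2 (Finset.mem_Ico.1 ht).2) fun t _ _ => hg t
  rw [Finset.sum_const, Nat.card_Ico, show 2 * n - n = n by omega, nsmul_eq_mul] at h1
  push_cast at h
  linarith

/-- If q ≤ s the nonnegative square (q - s)² is added to the bound; otherwise the cross term -2 s x
is dropped. -/
lemma max_sub_add_sq_le {q s x : ℝ} (hq : 0 ≤ q) (hs : 0 ≤ s) (hx : 0 ≤ x) :
    (max (q - s) 0 + x) ^ 2 ≤ q ^ 2 + x ^ 2 + s ^ 2 + 2 * (q * x - q * s) := by
  rcases le_total (q - s) 0 with h | h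
  · rw [max_eq_right h]
    nlinarith [mul_nonneg hq hx, sq_nonneg (q - s)]
  · rw [max_eq_left h]
    nlinarith [mul_nonneg hs hx]

namespace Network

variable {p : Params} {b : Backhaul} {μ : Measure Ω} {c : ℕ → Ω → p.Fading}
  {a : Fin p.N → ℝ} {A : ℕ → Ω → Fin p.N → ℝ} {π : Policy p.N} {q₀ : Fin p.N → ℝ}

lemma mean_nonneg (h : Network p b μ c a A π q₀) (k : Fin p.N) : 0 ≤ a k := by
  obtain ⟨M, hM⟩ := h.arrival.bounded
  rw [← h.arrival.mean 0 k]
  exact integral_nonneg_of_ae ((hM 0 k).mono fun ω hω => hω.1)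

variable [IsProbabilityMeasure μ]

lemma integral_queue_nonneg (h : Network p b μ c a A π q₀) (t : ℕ) (k : Fin p.N) :
    0 ≤ ∫ ω, p.queue b c π A q₀ t ω k ∂μ :=
  integral_nonneg_of_ae ((h.ae_queue_nonneg t).mono fun _ hω => hω k)

lemma lintegral_average_eq (h : Network p b μ c a A π q₀) (k : Fin p.N) {T : ℕ} (hT : 1 ≤ T) :
    (∑ t ∈ Finset.range T, ∫⁻ ω, ENNReal.ofReal (p.queue b c π A q₀ t ω k) ∂μ) / (T : ENNReal) =
      ENNReal.ofReal ((∑ t ∈ Finset.range T, ∫ ω, p.queue b c π A q₀ t ω k ∂μ) / T) := by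
  have hT' : (0 : ℝ) < T := by exact_mod_cast hT
  rw [ENNReal.ofReal_div_of_pos hT', ENNReal.ofReal_natCast,
    ENNReal.ofReal_sum_of_nonneg fun t _ => h.integral_queue_nonneg t k]
  congr 1
  exact Finset.sum_congr rfl fun t _ => (ofReal_integral_eq_lintegral_ofReal
    (h.integrable_queue t k) ((h.ae_queue_nonneg t).mono fun _ hω => hω k)).symm

lemma stronglyStable_of_sum_le (h : Network p b μ c a A π q₀) {M : ℝ}
    (hM : ∀ (k : Fin p.N) (T : ℕ), 1 ≤ T →
      ∑ t ∈ Finset.range T, ∫ ω, p.queue b c π A q₀ t ω k ∂μ ≤ M * T) :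
    StronglyStable μ (p.queue b c π A q₀) := by
  intro k
  refine (limsup_le_of_le (a := ENNReal.ofReal M) (by isBoundedDefault) ?_).trans_lt
    ENNReal.ofReal_lt_top
  filter_upwards [eventually_ge_atTop 1] with T hT
  rw [h.lintegral_average_eq k hT]
  refine ENNReal.ofReal_le_ofReal ?_
  rw [div_le_iff₀ (by exact_mod_cast hT)]
  exact hM k T hT

lemma exists_sum_le_of_stronglyStable (h : Network p b μ c a A π q₀)
    (hs : StronglyStable μ (p.queue b c π A q₀)) :
    ∃ M : ℝ, ∀ᶠ T : ℕ in atTop,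
      ∑ t ∈ Finset.range T, ∑ k, ∫ ω, p.queue b c π A q₀ t ω k ∂μ ≤ M * T := by
  choose M hM hM' using fun k => ENNReal.lt_iff_exists_nnreal_btwn.1 (hs k)
  refine ⟨∑ k, (M k : ℝ), ?_⟩
  filter_upwards [eventually_ge_atTop 1,
    eventually_all.2 fun k => eventually_lt_of_limsup_lt (hM k)] with T hT h1
  rw [Finset.sum_comm, Finset.sum_mul]
  refine Finset.sum_le_sum fun k _ => ?_
  have h2 := (h1 k).le
  have hT' : (0 : ℝ) < T := by exact_mod_cast hT
  rwa [h.lintegral_average_eq k hT, ← ENNReal.ofReal_coe_nnreal,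
    ENNReal.ofReal_le_ofReal_iff (M k).coe_nonneg, div_le_iff₀ hT'] at h2

/-- Drift of the quadratic Lyapunov function. -/
lemma lyapunov_drift (h : Network p b μ c a A π q₀) :
    ∃ C : ℝ, 0 ≤ C ∧ ∀ t, ∫ ω, ∑ k, p.queue b c π A q₀ (t + 1) ω k ^ 2 ∂μ ≤
      ∫ ω, ∑ k, p.queue b c π A q₀ t ω k ^ 2 ∂μ + C +
        2 * ∫ ω, (∑ k, a k * p.queue b c π A q₀ t ω k -
          p.weight b (p.queue b c π A q₀ t ω) (π (p.queue b c π A q₀ t ω))) ∂μ := by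
  obtain ⟨K, hK0, hK⟩ := h.exists_bound
  refine ⟨∑ _k : Fin p.N, (K ^ 2 + (p.d * p.R) ^ 2), Finset.sum_nonneg fun _ _ => by positivity,
    fun t => ?_⟩
  have hiA : ∀ k, Integrable (fun ω => p.queue b c π A q₀ t ω k * A t ω k) μ := fun k => by
    refine (h.integrable_queue t k).mul_bdd (c := K) (h.integrable_arrival t k).aestronglyMeasurable
      (hK.mono fun ω hω => ?_)
    rw [Real.norm_eq_abs, abs_of_nonneg (hω t k).1.1]
    exact (hω t k).1.2
  have hB := fun k => h.integrable_and_integral_mul_service t (measurable_pi_apply k)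
    (h.integrable_queue t k) k
  have hX : ∀ k, Integrable (fun ω => p.queue b c π A q₀ t ω k * A t ω k -
      p.queue b c π A q₀ t ω k *
        p.service b (c t ω) (π (p.queue b c π A q₀ t ω)) k) μ := fun k => (hiA k).sub (hB k).1
  have hY : ∀ k, Integrable (fun ω => a k * p.queue b c π A q₀ t ω k -
      p.rate b (π (p.queue b c π A q₀ t ω)) k * p.queue b c π A q₀ t ω k) μ := fun k => by
    refine ((h.integrable_queue t k).const_mul _).sub ((hB k).2.1.congr ?_)
    exact Eventually.of_forall fun ω => mul_comm _ _
  have hXY : ∀ k, ∫ ω, (p.queue b c π A q₀ t ω k * A t ω k -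
      p.queue b c π A q₀ t ω k * p.service b (c t ω) (π (p.queue b c π A q₀ t ω)) k) ∂μ =
      ∫ ω, (a k * p.queue b c π A q₀ t ω k -
        p.rate b (π (p.queue b c π A q₀ t ω)) k * p.queue b c π A q₀ t ω k) ∂μ := fun k => by
    rw [integral_sub (hiA k) (hB k).1, h.integral_queue_mul_arrival t k, (hB k).2.2,
      ← integral_sub ((h.integrable_queue t k).mul_const _) (hB k).2.1]
    refine integral_congr_ae (Eventually.of_forall fun ω => ?_)
    simp only
    ring
  have hpt : ∀ᵐ ω ∂μ, ∑ k, p.queue b c π A q₀ (t + 1) ω k ^ 2 ≤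
      ∑ k, p.queue b c π A q₀ t ω k ^ 2 + ∑ _k : Fin p.N, (K ^ 2 + (p.d * p.R) ^ 2) +
      2 * ∑ k, (p.queue b c π A q₀ t ω k * A t ω k -
        p.queue b c π A q₀ t ω k * p.service b (c t ω) (π (p.queue b c π A q₀ t ω)) k) := by
    filter_upwards [hK] with ω hω
    rw [Finset.mul_sum, ← Finset.sum_add_distrib, ← Finset.sum_add_distrib]
    refine Finset.sum_le_sum fun k _ => ?_
    have hS := h.valid.service_mem_Icc b (c t ω) (π (p.queue b c π A q₀ t ω)) k
    have h1 := max_sub_add_sq_le (hω t k).2.1 hS.1 (hω t k).1.1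
    have h2 := pow_le_pow_left₀ (hω t k).1.1 (hω t k).1.2 2
    have h3 := pow_le_pow_left₀ hS.1 hS.2 2
    rw [Params.queue]
    linarith
  have hisq : ∀ t, Integrable (fun ω => ∑ k, p.queue b c π A q₀ t ω k ^ 2) μ := fun t =>
    integrable_finsetSum _ fun k _ => h.integrable_queue_sq t k
  have hiX := (integrable_finsetSum Finset.univ fun k _ => hX k).const_mul 2
  have hmono := integral_mono_ae (hisq (t + 1)) (((hisq t).add (integrable_const _)).add hiX) hpt
  refine hmono.trans (le_of_eq ?_)
  rw [integral_add' ((hisq t).add (integrable_const _)) hiX,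
    integral_add' (hisq t) (integrable_const _), integral_const, integral_const_mul,
    integral_finsetSum _ fun k _ => hX k, Finset.sum_congr rfl fun k _ => hXY k,
    ← integral_finsetSum _ fun k _ => hY k]
  simp [Params.weight_eq, Finset.sum_sub_distrib]

/-- Max-weight scheduling stabilizes the queues when the mean arrival vector, slightly increased,
is in the region. -/
lemma stronglyStable_of_mem_region (h : Network p b μ c a A π q₀)
    (hπ : p.IsSwitchingPolicy b π) {ε : ℝ} (hε : 0 < ε)
    (ha : (fun k => a k + ε) ∈ p.region b) : StronglyStable μ (p.queue b c π A q₀) := by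
  obtain ⟨C, hC, hdrift⟩ := h.lyapunov_drift
  let V : ℕ → ℝ := fun t => ∫ ω, ∑ k, p.queue b c π A q₀ t ω k ^ 2 ∂μ
  let e : ℕ → ℝ := fun t => ∑ k, ∫ ω, p.queue b c π A q₀ t ω k ∂μ
  have hV : ∀ t, 0 ≤ V t := fun t =>
    integral_nonneg fun ω => Finset.sum_nonneg fun k _ => sq_nonneg _
  have hstep : ∀ t, V (t + 1) + 2 * ε * e t ≤ V t + C := by
    intro t
    have hle : ∫ ω, (∑ k, a k * p.queue b c π A q₀ t ω k -
        p.weight b (p.queue b c π A q₀ t ω) (π (p.queue b c π A q₀ t ω))) ∂μ ≤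
        ∫ ω, -ε * ∑ k, p.queue b c π A q₀ t ω k ∂μ := by
      refine integral_mono_ae ?_ ?_ ?_
      · refine (integrable_finsetSum _ fun k _ => (h.integrable_queue t k).const_mul _).sub ?_
        simp_rw [Params.weight_eq]
        refine integrable_finsetSum _ fun k _ => ?_
        refine (h.integrable_and_integral_mul_service t (measurable_pi_apply k)
          (h.integrable_queue t k) k).2.1.congr (Eventually.of_forall fun ω => mul_comm _ _)
      · exact (integrable_finsetSum _ fun k _ => h.integrable_queue t k).const_mul _
      · filter_upwards [h.ae_queue_nonneg t] with ω hω
        -- The Max-Weight value bounds the functional x ↦ x · q on all of Λ, in particular at a +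
        -- ε(1,…,1); this leaves a drift of at most -ε ∑ q_k.
        have := Params.sum_mul_le_of_mem_region ha (p.queue b c π A q₀ t ω) (hπ.2 _ hω)
        simp_rw [add_mul, Finset.sum_add_distrib, ← Finset.mul_sum] at this
        linarith
    rw [integral_const_mul, integral_finsetSum _ fun k _ => h.integrable_queue t k] at hle
    have := hdrift t
    simp only [V, e]
    linarith
  have hsum : ∀ T, V T + 2 * ε * ∑ t ∈ Finset.range T, e t ≤ V 0 + C * T := by
    intro T
    induction T with
    | zero => simp
    | succ T ih =>
      rw [Finset.sum_range_succ]
      push_cast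
      linarith [hstep T]
  -- The telescoped drift bounds 2ε ∑ e by V 0 + C T, and V 0 ≤ V 0 * T because T ≥ 1.
  refine h.stronglyStable_of_sum_le (M := (V 0 + C) / (2 * ε)) fun k T hT => ?_
  have hT' : (1 : ℝ) ≤ T := by exact_mod_cast hT
  have h1 : ∑ t ∈ Finset.range T, ∫ ω, p.queue b c π A q₀ t ω k ∂μ ≤
      ∑ t ∈ Finset.range T, e t := Finset.sum_le_sum fun t _ =>
    Finset.single_le_sum (f := fun k => ∫ ω, p.queue b c π A q₀ t ω k ∂μ)
      (fun k _ => h.integral_queue_nonneg t k) (Finset.mem_univ k)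
  refine h1.trans ?_
  rw [div_mul_eq_mul_div, le_div_iff₀ (by positivity)]
  nlinarith [hsum T, hV T, mul_nonneg (hV 0) (sub_nonneg.2 hT')]

lemma integrable_rate (h : Network p b μ c a A π q₀) (t : ℕ) (k : Fin p.N) :
    Integrable (fun ω => p.rate b (π (p.queue b c π A q₀ t ω)) k) μ := by
  simpa using (h.integrable_and_integral_mul_service t (g := fun _ => 1) measurable_const
    (integrable_const _) k).2.1

/-- The mean service rate vector of each slot is in the region. -/
lemma integral_rate_mem_region (h : Network p b μ c a A π q₀) (hreg : p.IARateRegular b) (t : ℕ) :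
    (fun k => ∫ ω, p.rate b (π (p.queue b c π A q₀ t ω)) k ∂μ) ∈ p.region b := by
  have hi : ∀ k, Integrable (fun ω => p.rate b (π (p.queue b c π A q₀ t ω)) k) μ :=
    h.integrable_rate t
  have := (Params.convex_region b).integral_mem (μ := μ) (Params.isClosed_region b)
    (Eventually.of_forall fun ω => Params.rate_mem_region hreg (π (p.queue b c π A q₀ t ω)))
    (Integrable.of_eval hi)
  convert! this using 1
  ext k
  exact (eval_integral hi k).symm

/-- Discarding the truncation at 0 can only lower the queue; summed over time, this bounds arrivals
minus service by the mean backlog. -/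
lemma integral_queue_succ_ge (h : Network p b μ c a A π q₀) (t : ℕ) (k : Fin p.N) :
    ∫ ω, p.queue b c π A q₀ t ω k ∂μ + a k - ∫ ω, p.rate b (π (p.queue b c π A q₀ t ω)) k ∂μ ≤
      ∫ ω, p.queue b c π A q₀ (t + 1) ω k ∂μ := by
  have hs := h.integrable_and_integral_mul_service t (g := fun _ => 1) measurable_const
    (integrable_const _) k
  simp only [one_mul] at hs
  rw [← hs.2.2, ← h.arrival.mean t k,
    ← integral_add' (h.integrable_queue t k) (h.integrable_arrival t k),
    ← integral_sub' ((h.integrable_queue t k).add (h.integrable_arrival t k)) hs.1]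
  refine integral_mono (((h.integrable_queue t k).add (h.integrable_arrival t k)).sub hs.1)
    (h.integrable_queue (t + 1) k) fun ω => ?_
  simp only [Params.queue, Pi.add_apply, Pi.sub_apply]
  linarith [le_max_left (p.queue b c π A q₀ t ω k -
    p.service b (c t ω) (π (p.queue b c π A q₀ t ω)) k) 0]

/-- No policy stabilizes the queues for a mean arrival vector outside the region. -/
lemma mem_region_of_stronglyStable (h : Network p b μ c a A π q₀) (hreg : p.IARateRegular b)
    (hs : StronglyStable μ (p.queue b c π A q₀)) : a ∈ p.region b := by
  obtain ⟨M, hM⟩ := h.exists_sum_le_of_stronglyStable hs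
  obtain ⟨T₀, hT₀⟩ := eventually_atTop.1 hM
  let ρ : ℕ → Fin p.N → ℝ := fun t k => ∫ ω, p.rate b (π (p.queue b c π A q₀ t ω)) k ∂μ
  have hsum : ∀ (T : ℕ) (k : Fin p.N),
      T * a k - ∑ t ∈ Finset.range T, ρ t k ≤ ∫ ω, p.queue b c π A q₀ T ω k ∂μ := by
    intro T k
    induction T with
    | zero => simpa using h.integral_queue_nonneg 0 k
    | succ T ih =>
      rw [Finset.sum_range_succ]
      have := h.integral_queue_succ_ge T k
      push_cast
      simp only [ρ] at ih ⊢
      linarith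
  -- Some T ≥ n has mean total backlog at most 2M, so a k - 2M/n is at most the averaged service
  -- over the first T slots. The maximum with 0 is there because coordinate-convexity only reaches
  -- nonnegative vectors.
  have hmem : ∀ᶠ n : ℕ in atTop, (fun k => max (a k - 2 * M / n) 0) ∈ p.region b := by
    filter_upwards [eventually_ge_atTop (max T₀ 1)] with n hn
    have hn1 : 1 ≤ n := (le_max_right _ _).trans hn
    have he : ∀ t, 0 ≤ ∑ k, ∫ ω, p.queue b c π A q₀ t ω k ∂μ := fun t =>
      Finset.sum_nonneg fun k _ => h.integral_queue_nonneg t k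
    obtain ⟨T, hnT, hT⟩ := exists_mem_Ico_le_of_sum_le he hn1
      (hT₀ (2 * n) (by have := (le_max_left T₀ 1).trans hn; omega))
    have hn0 : (0 : ℝ) < n := by exact_mod_cast hn1
    have hnT' : (n : ℝ) ≤ T := by exact_mod_cast hnT
    have hT0 : (0 : ℝ) < T := hn0.trans_le hnT'
    have hM0 : 0 ≤ 2 * M := (he T).trans hT
    have hu : ∑ t ∈ Finset.range T, (T : ℝ)⁻¹ • ρ t ∈ p.region b :=
      (Params.convex_region b).sum_mem (fun _ _ => by positivity)
        (by rw [Finset.sum_const, Finset.card_range, nsmul_eq_mul, mul_inv_cancel₀ hT0.ne'])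
        fun t _ => h.integral_rate_mem_region hreg t
    have hval : ∀ k, (∑ t ∈ Finset.range T, (T : ℝ)⁻¹ • ρ t) k =
        (∑ t ∈ Finset.range T, ρ t k) / T := fun k => by
      rw [Finset.sum_apply, div_eq_inv_mul, Finset.mul_sum]; rfl
    refine Params.mem_region_of_le hreg hu (fun k => le_max_right _ _) fun k => ?_
    rw [hval]
    refine max_le ?_ (div_nonneg (Finset.sum_nonneg fun t _ =>
      integral_nonneg fun ω => h.rate_nonneg _ k) hT0.le)
    have h1 : ∫ ω, p.queue b c π A q₀ T ω k ∂μ ≤ 2 * M :=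
      (Finset.single_le_sum (f := fun k => ∫ ω, p.queue b c π A q₀ T ω k ∂μ)
        (fun k _ => h.integral_queue_nonneg T k) (Finset.mem_univ k)).trans hT
    have h2 : 2 * M / T ≤ 2 * M / n := div_le_div_of_nonneg_left hM0 hn0 hnT'
    have h3 : a k - 2 * M / T ≤ (∑ t ∈ Finset.range T, ρ t k) / T := by
      rw [sub_le_iff_le_add, ← add_div, le_div_iff₀ hT0]
      linarith [hsum T k]
    linarith
  refine (Params.isClosed_region b).mem_of_tendsto ?_ hmem
  refine tendsto_pi_nhds.2 fun k => ?_
  have h1 : Tendsto (fun n : ℕ => a k - 2 * M / n) atTop (𝓝 (a k - 0)) :=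
    tendsto_const_nhds.sub (tendsto_const_div_atTop_nhds_zero_nat _)
  have h2 := h1.max (tendsto_const_nhds (x := (0 : ℝ)))
  rwa [sub_zero, max_eq_left (h.mean_nonneg k)] at h2

end Network

/-! ### Relative interior points and conclusion. -/

lemma exists_add_mem_of_mem_orthantInterior {N : ℕ} {Λ : Set (Fin N → ℝ)} {a : Fin N → ℝ}
    (ha : a ∈ orthantInterior Λ) : ∃ ε : ℝ, 0 < ε ∧ (fun k => a k + ε) ∈ Λ := by
  have h1 : Tendsto (fun ε : ℝ => fun k => a k + ε) (𝓝[>] 0) (𝓝 a) := by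
    have : Tendsto (fun ε : ℝ => fun k => a k + ε) (𝓝 0) (𝓝 fun k => a k + 0) :=
      Continuous.tendsto (by fun_prop) 0
    simp only [add_zero] at this
    exact this.mono_left nhdsWithin_le_nhds
  -- Increasing all coordinates equally stays in the orthant, so the relative neighbourhood applies
  -- even when `a` has zero coordinates.
  have h2 : Tendsto (fun ε : ℝ => fun k => a k + ε) (𝓝[>] 0) (𝓝[{x | ∀ k, 0 ≤ x k}] a) :=
    tendsto_nhdsWithin_iff.2 ⟨h1, by
      filter_upwards [self_mem_nhdsWithin] with ε hε k
      exact add_nonneg (ha.1 k) (le_of_lt hε)⟩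
  obtain ⟨ε, hε, h3⟩ := ((h2.eventually ha.2).and self_mem_nhdsWithin).exists
  exact ⟨ε, h3, hε⟩

lemma Params.Valid.isSwitchingRegion {p : Params} (hp : p.Valid) {b : Backhaul} {μ : Measure Ω}
    [IsProbabilityMeasure μ] {c : ℕ → Ω → p.Fading} (hslots : iIndepFun c μ)
    (hb : b = .imperfect → 3 ≤ p.Nt * p.Nr) (hc : ∀ t, p.IsSlotFading b μ (c t))
    (hreg : p.IARateRegular b) : p.IsSwitchingRegion b μ c (p.region b) := by
  refine ⟨fun π hπ => ⟨fun a ha => ⟨ha.1, fun A q₀ hA hq => ?_⟩, fun a ha => ?_⟩,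
    fun π a A q₀ hπ hA hq hs => ?_⟩
  · obtain ⟨ε, hε, hmem⟩ := exists_add_mem_of_mem_orthantInterior ha
    exact Network.stronglyStable_of_mem_region ⟨hp, hb, hc, hA, hπ.1, hq⟩ hπ hε hmem
  · have hA := Params.isArrival_const hslots ha.1
    exact Network.mem_region_of_stronglyStable
      ⟨hp, hb, hc, hA, hπ.1, fun _ => le_rfl⟩ hreg (ha.2 _ (fun _ => 0) hA fun _ => le_rfl)
  · exact Network.mem_region_of_stronglyStable ⟨hp, hb, hc, hA, hπ, hq⟩ hreg hs

end IASVD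

theorem mainTheorem6 (p : IASVD.Params) (hp : p.Valid) {Ω : Type*} [MeasurableSpace Ω]
    (μ : MeasureTheory.Measure Ω) [MeasureTheory.IsProbabilityMeasure μ]
    (c : ℕ → Ω → p.Fading)
    (hslots : ProbabilityTheory.iIndepFun c μ) :
    (3 ≤ p.Nt * p.Nr → (∀ t, p.IsSlotFading .imperfect μ (c t)) →
      p.IsSwitchingRegion .imperfect μ c (p.region .imperfect)) ∧
    ((∀ t, p.IsSlotFading .perfect μ (c t)) →
      p.IsSwitchingRegion .perfect μ c (p.region .perfect)) :=
  ⟨fun h3 hc => hp.isSwitchingRegion hslots (fun _ => h3) hc (hp.regular_imperfect h3),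
    fun hc => hp.isSwitchingRegion hslots (fun h => by cases h) hc hp.regular_perfect⟩
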